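/- Let $\Gamma\subset \mathrm{PSL}(2,\mathbb{R})$ be a discrete subgroup of finite covolume, acting on the upper half-plane $\mathcal{H}$. Say that $f:\mathcal{H}\to\mathbb{C}$ has moderate growth if $|f(z)|\le C\,\big((1+|z|^2)/\operatorname{Im} z\big)^N$ on $\mathcal H$ for some constants $C,N$. Let $M_k=M_k(\Gamma)$ be the space of modular forms of weight $k$: holomorphic functions $f$ on $\mathcal{H}$ of moderate growth with $(cz+d)^{-k}f\big(\tfrac{az+b}{cz+d}\big)=f(z)$ for all $\begin{pmatrix}a&b\\c&d\end{pmatrix}\in\Gamma$. Let $\widetilde M_k=\widetilde M_k(\Gamma)$ be the space of quasimodular forms of weight $k$: holomorphic functions $f$ on $\mathcal{H}$ of moderate growth for which there are $p\ge 0$ and functions $f_0,\dots,f_p:\mathcal{H}\to\mathbb{C}$ with $$(cz+d)^{-k}f\Big(\frac{az+b}{cz+d}\Big)=\sum_{j=0}^p f_j(z)\Big(\frac{c}{cz+d}\Big)^j\qquad\text{for all } z\in\mathcal{H},\ \begin{pmatrix}a&b\\c&d\end{pmatrix}\in\Gamma .$$ Let $\widetilde M_*=\bigoplus_{k\ge 0}\widetilde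 M_k$, let $M_{>0}=\bigoplus_{k>0}M_k$, and let $D=d/dz$, which raises the weight by $2$. Theorem. For $f\in\widetilde M_2$ the coefficient $f_1$ (with $f_1=0$ if $p=0$) is a constant which depends only on $f$, and $\delta(f):=f_1$ defines a linear map $\delta:\widetilde M_2\to\mathbb{C}$ such that $$0\longrightarrow M_2\longrightarrow\widetilde M_2\stackrel{\delta}{\longrightarrow}\mathbb{C}$$ is exact. Either $\delta=0$ or there is $\phi\in\widetilde M_2$ with $\delta(\phi)=1$, and not both. If $\delta=0$, then $$\widetilde M_*=\mathbb{C}\oplus\bigoplus_{i=0}^\infty D^i(M_{>0}).$$ If $\phi\in\widetilde M_2$ satisfies $\delta(\phi)=1$, then $$\widetilde M_*=\mathbb{C}\oplus\bigoplus_{i=0}^\infty D^i(M_{>0})\oplus\bigoplus_{i=0}^\infty\mathbb{C}\,D^i(\phi),$$ where every $D^i(\phi)$ is non-zero. -/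

import Mathlib

open scoped MatrixGroups UpperHalfPlane Manifold DirectSum Polynomial
open UpperHalfPlane

noncomputable section

namespace QuasiMod

/-- The centre of `SL(2, ℝ)` acts trivially on the upper half-plane. -/
lemma center_le_ker :
    Subgroup.center SL(2, ℝ) ≤ (MulAction.toPermHom SL(2, ℝ) ℍ).ker := by
  intro g hg
  rw [Matrix.SpecialLinearGroup.mem_center_iff] at hg
  obtain ⟨r, hr, hg⟩ := hg
  have hr0 : r ≠ 0 := by
    rintro rfl
    simp at hr
  have hc : ((r : ℝ) : ℂ) ≠ 0 := by exact_mod_cast hr0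
  rw [MonoidHom.mem_ker]
  ext z
  have h00 : g 0 0 = r := by rw [← hg]; simp
  have h01 : g 0 1 = 0 := by rw [← hg]; simp
  have h10 : g 1 0 = 0 := by rw [← hg]; simp
  have h11 : g 1 1 = r := by rw [← hg]; simp
  simp only [MulAction.toPermHom_apply, MulAction.toPerm_apply, Equiv.Perm.coe_one, id_eq]
  rw [UpperHalfPlane.coe_specialLinearGroup_apply]
  simp [h00, h01, h10, h11, hc]

/-- The action of `PSL(2, ℝ)` on the upper half-plane by Möbius transformations, induced from the
action of `SL(2, ℝ)`. -/
instance pslAction : MulAction PSL(2, ℝ) ℍ :=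
  MulAction.compHom ℍ
    (QuotientGroup.lift (Subgroup.center SL(2, ℝ)) (MulAction.toPermHom SL(2, ℝ) ℍ) center_le_ker)

lemma psl_smul_mk (g : SL(2, ℝ)) (z : ℍ) : (g : PSL(2, ℝ)) • z = g • z := rfl

/-- `Γ` has finite covolume: it has a fundamental domain of finite hyperbolic area (the measure on
`ℍ` is `dx dy / y ^ 2`). -/
def FiniteCovolume (Γ : Subgroup PSL(2, ℝ)) : Prop :=
  ∃ F : Set ℍ, MeasureTheory.IsFundamentalDomain Γ F MeasureTheory.volume ∧
    MeasureTheory.volume F < ⊤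

/-- The factor `c z + d` of a matrix with lower row `(c, d)`. -/
def cocycle (g : SL(2, ℝ)) (z : ℍ) : ℂ := (g 1 0 : ℂ) * z + (g 1 1 : ℂ)

/-- The space of holomorphic functions on the upper half-plane. -/
def Hol : Submodule ℂ (ℍ → ℂ) where
  carrier := {f | MDiff f}
  add_mem' hf hg := hf.add hg
  zero_mem' := mdifferentiable_const
  smul_mem' c _ hf := MDifferentiable.const_smul c hf

/-- The derivation `D = d/dz` on holomorphic functions. -/
def D : Hol →ₗ[ℂ] Hol where
  toFun f := ⟨fun z => deriv ((f : ℍ → ℂ) ∘ ofComplex) z, by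
    have hF : MDiff (f : ℍ → ℂ) := f.2
    change MDiff (fun z : ℍ => deriv ((f : ℍ → ℂ) ∘ ofComplex) z)
    rw [UpperHalfPlane.mdifferentiable_iff] at hF ⊢
    refine (hF.deriv isOpen_upperHalfPlaneSet).congr fun z hz => ?_
    simp [Function.comp_apply, ofComplex_apply_of_im_pos hz]⟩
  map_add' f g := by
    ext z
    exact deriv_add (UpperHalfPlane.mdifferentiableAt_iff.mp (f.2 z))
      (UpperHalfPlane.mdifferentiableAt_iff.mp (g.2 z))
  map_smul' c f := by
    ext z
    exact deriv_fun_const_smul c (UpperHalfPlane.mdifferentiableAt_iff.mp (f.2 z))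

/-- Moderate growth: `f` is bounded by a polynomial in `(1 + |z|²) / y`. -/
def ModerateGrowth (f : ℍ → ℂ) : Prop :=
  ∃ (C : ℝ) (N : ℕ), ∀ z : ℍ, ‖f z‖ ≤ C * ((1 + ‖(z : ℂ)‖ ^ 2) / z.im) ^ N

lemma one_le_growth (z : ℍ) : 1 ≤ (1 + ‖(z : ℂ)‖ ^ 2) / z.im := by
  rw [le_div_iff₀ z.im_pos]
  have h : z.im ≤ ‖(z : ℂ)‖ := (le_abs_self _).trans (Complex.abs_im_le_norm (z : ℂ))
  nlinarith [sq_nonneg (‖(z : ℂ)‖ - 1), norm_nonneg (z : ℂ)]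

lemma ModerateGrowth.zero : ModerateGrowth 0 := ⟨0, 0, fun z => by simp⟩

lemma ModerateGrowth.add {f g : ℍ → ℂ} (hf : ModerateGrowth f) (hg : ModerateGrowth g) :
    ModerateGrowth (f + g) := by
  obtain ⟨C, N, hf⟩ := hf
  obtain ⟨C', N', hg⟩ := hg
  refine ⟨|C| + |C'|, max N N', fun z => ?_⟩
  have h1 := one_le_growth z
  have a1 := pow_le_pow_right₀ h1 (le_max_left N N')
  have a2 := pow_le_pow_right₀ h1 (le_max_right N N')
  have b1 : (0 : ℝ) ≤ ((1 + ‖(z : ℂ)‖ ^ 2) / z.im) ^ N := by positivity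
  have b2 : (0 : ℝ) ≤ ((1 + ‖(z : ℂ)‖ ^ 2) / z.im) ^ N' := by positivity
  calc ‖(f + g) z‖ ≤ ‖f z‖ + ‖g z‖ := norm_add_le _ _
    _ ≤ C * ((1 + ‖(z : ℂ)‖ ^ 2) / z.im) ^ N + C' * ((1 + ‖(z : ℂ)‖ ^ 2) / z.im) ^ N' :=
        add_le_add (hf z) (hg z)
    _ ≤ |C| * ((1 + ‖(z : ℂ)‖ ^ 2) / z.im) ^ N + |C'| * ((1 + ‖(z : ℂ)‖ ^ 2) / z.im) ^ N' := by
        gcongr <;> exact le_abs_self _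
    _ ≤ _ := by
        rw [add_mul]
        gcongr

lemma ModerateGrowth.smul {f : ℍ → ℂ} (c : ℂ) (hf : ModerateGrowth f) :
    ModerateGrowth (c • f) := by
  obtain ⟨C, N, hf⟩ := hf
  refine ⟨‖c‖ * C, N, fun z => ?_⟩
  rw [Pi.smul_apply, norm_smul, mul_assoc]
  exact mul_le_mul_of_nonneg_left (hf z) (norm_nonneg c)

/-- Modular forms of weight `k` over `Γ`: holomorphic functions of moderate growth with
`(c z + d) ^ (-k) f((a z + b) / (c z + d)) = f(z)` for all matrices representing elements of
`Γ`. -/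
def modularForms (Γ : Subgroup PSL(2, ℝ)) (k : ℤ) : Submodule ℂ Hol where
  carrier := {f | ModerateGrowth f ∧ ∀ g : SL(2, ℝ), (g : PSL(2, ℝ)) ∈ Γ → ∀ z : ℍ,
    cocycle g z ^ (-k) * (f : ℍ → ℂ) (g • z) = (f : ℍ → ℂ) z}
  add_mem' hf hg := ⟨hf.1.add hg.1, fun γ hγ z => by
    simpa [mul_add] using congrArg₂ (· + ·) (hf.2 γ hγ z) (hg.2 γ hγ z)⟩
  zero_mem' := ⟨ModerateGrowth.zero, fun γ _ z => by simp⟩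
  smul_mem' c f hf := ⟨hf.1.smul c, fun γ hγ z => by
    simpa [mul_left_comm] using congrArg (c * ·) (hf.2 γ hγ z)⟩

/-- For every `z`, the map `γ ↦ (c z + d) ^ (-k) f((a z + b) / (c z + d))` on `Γ` is the polynomial
`P z`, of degree at most `p`, in `c / (c z + d)`; the coefficient function `f_j` of the
expansion is `z ↦ (P z).coeff j`. -/
def IsExpansion (Γ : Subgroup PSL(2, ℝ)) (k : ℤ) (p : ℕ) (f : ℍ → ℂ) (P : ℍ → ℂ[X]) : Prop :=
  (∀ z : ℍ, (P z).natDegree ≤ p) ∧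
    ∀ g : SL(2, ℝ), (g : PSL(2, ℝ)) ∈ Γ → ∀ z : ℍ,
      cocycle g z ^ (-k) * f (g • z) = (P z).eval ((g 1 0 : ℂ) / cocycle g z)

/-- Quasimodular forms of weight `k` (and arbitrary depth) over `Γ`. -/
def quasimodularForms (Γ : Subgroup PSL(2, ℝ)) (k : ℤ) : Submodule ℂ Hol where
  carrier := {f | ModerateGrowth f ∧ ∃ (p : ℕ) (P : ℍ → ℂ[X]), IsExpansion Γ k p f P}
  add_mem' := by
    rintro f g ⟨hf, p, P, hP, hP'⟩ ⟨hg, q, Q, hQ, hQ'⟩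
    refine ⟨hf.add hg, max p q, fun z => P z + Q z, fun z => ?_, fun γ hγ z => ?_⟩
    · exact (Polynomial.natDegree_add_le _ _).trans (max_le_max (hP z) (hQ z))
    · simpa [mul_add] using congrArg₂ (· + ·) (hP' γ hγ z) (hQ' γ hγ z)
  zero_mem' := ⟨ModerateGrowth.zero, 0, 0, fun z => by simp, fun γ _ z => by simp⟩
  smul_mem' := by
    rintro c f ⟨hf, p, P, hP, hP'⟩
    refine ⟨hf.smul c, p, fun z => c • P z, fun z => ?_, fun γ hγ z => ?_⟩
    · exact (Polynomial.natDegree_smul_le _ _).trans (hP z)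
    · simpa [mul_left_comm] using congrArg (c * ·) (hP' γ hγ z)

/-- Modular forms are quasimodular (of depth `0`). -/
lemma modularForms_le (Γ : Subgroup PSL(2, ℝ)) (k : ℤ) :
    modularForms Γ k ≤ quasimodularForms Γ k := by
  rintro f ⟨hf, h⟩
  refine ⟨hf, 0, fun z => Polynomial.C ((f : ℍ → ℂ) z), fun z => by simp, fun γ hγ z => ?_⟩
  simpa using h γ hγ z

/-- The ambient space `⨁_{k ≥ 0} Hol` in which the graded spaces of forms live: its elements are
finite families of holomorphic functions indexed by their weight. -/
abbrev GrHol : Type := ⨁ _ : ℕ, Hol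

/-- A holomorphic function, placed in weight `k`. -/
def inWeight (k : ℕ) : Hol →ₗ[ℂ] GrHol := DirectSum.lof ℂ ℕ (fun _ => Hol) k

/-- The derivation `D` on graded spaces; it raises the weight by `2`. -/
def gradedD : Module.End ℂ GrHol :=
  DirectSum.toModule ℂ ℕ GrHol fun k => inWeight (k + 2) ∘ₗ D

/-- `⨁_{k ≥ 0} M̃_k(Γ)`. -/
def gradedQuasimodularForms (Γ : Subgroup PSL(2, ℝ)) : Submodule ℂ GrHol :=
  ⨆ k : ℕ, (quasimodularForms Γ k).map (inWeight k)

/-- `⨁_{k > 0} M_k(Γ)`, the graded space of modular forms of positive weight. -/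
def gradedModularFormsPos (Γ : Subgroup PSL(2, ℝ)) : Submodule ℂ GrHol :=
  ⨆ k : ℕ, (modularForms Γ ((k + 1 : ℕ) : ℤ)).map (inWeight (k + 1))

/-- The constant functions, in weight `0`. -/
def gradedConstants : Submodule ℂ GrHol :=
  Submodule.span ℂ {inWeight 0 ⟨fun _ => 1, mdifferentiable_const⟩}

/-- `V` is the internal direct sum of the subspaces `W i`. -/
def IsDirectSumOf {ι : Type} (V : Submodule ℂ GrHol) (W : ι → Submodule ℂ GrHol) : Prop :=
  iSupIndep W ∧ V = ⨆ i, W i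

/-- The family of subspaces `ℂ` and `D^i(⨁_{k > 0} M_k(Γ))`, `i ≥ 0`. -/
def modularSummands (Γ : Subgroup PSL(2, ℝ)) : Unit ⊕ ℕ → Submodule ℂ GrHol
  | .inl _ => gradedConstants
  | .inr i => (gradedModularFormsPos Γ).map (gradedD ^ i)

/-- The family of subspaces `ℂ · D^i(φ)`, `i ≥ 0`, for `φ` of weight `2`. -/
def lineSummands (φ : Hol) (i : ℕ) : Submodule ℂ GrHol :=
  Submodule.span ℂ {(gradedD ^ i) (inWeight 2 φ)}

end QuasiMod

end

/-! The expansion of a quasimodular form `f` of weight k is a polynomial in c / (cz + d). Two facts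
about `Γ` carry the theorem. First, c / (cz + d) takes infinitely many values (`infinite_ratio`).
Expansions are therefore unique, their coefficients are holomorphic of moderate growth, and a top
coefficient f_n is modular of weight k - 2n (`HasExpansion.exists_leadingCoeff`). Second, modular
forms of negative weight vanish and those of weight 0 are constant. Hence n ≤ k/2 whenever f_n ≠ 0,
and in weight 2 the coefficient f_1 is a constant.

Differentiation turns the top coefficient f_n into (k - n) f_n, in degree n + 1. So if k > 2n, a
nonzero multiple of D^n(f_n) has the same top coefficient as `f`, and subtracting it lowers the
depth. The exception is k = 2n, where f_n is a constant. For n > 0 the coefficient f_(n-1) is then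
quasimodular of weight 2 with `δ` equal to n f_n; either `δ` = 0 and f_n = 0, or a multiple of
D^(n-1)(φ) can be subtracted. The sum is direct because in a fixed weight different summands have
different depths, so top coefficients cannot cancel.

Neither fact needs a description of the cusps. For `f` of weight -m, log⁺(|f|² y^(-m)) is invariant,
satisfies the sub-mean-value inequality and grows at most linearly in the hyperbolic distance. On a
quotient of finite volume such a function agrees almost everywhere with its averages over discs
(`ae_eq_lintegral_ball`). Applied to all multiples f/q, this makes almost every point a local
maximum of |f|² y^(-m), and the maximum principle concludes. As for the ratios, if they were finite
in number, the upper triangular elements would have finite index in `Γ`; these commute with x + iy ↦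
x + ity, which rescales area by an arbitrary factor, against finite covolume. -/

noncomputable section

namespace QuasiMod

/-! ### Ball averages on a quotient of finite volume -/

section Averaging

open MeasureTheory Metric Filter Topology
open scoped ENNReal

variable {X G : Type*} [PseudoMetricSpace X] [Group G] [MulAction G X]

lemma infDist_orbit_smul [IsIsometricSMul G X] (x₀ x : X) (g : G) :
    infDist (g • x) (MulAction.orbit G x₀) = infDist x (MulAction.orbit G x₀) := by
  have h : (fun y => g • y) '' MulAction.orbit G x₀ = MulAction.orbit G x₀ :=
    MulAction.smul_orbit g x₀
  conv_lhs => rw [← h]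
  exact infDist_image (isometry_smul X g)

/-- A cutoff function on the quotient, equal to `1` within distance `R` of the orbit of `x₀` and
to `0` at distance at least `2 R`. -/
def orbitCutoff (G : Type*) {X : Type*} [PseudoMetricSpace X] [Group G] [MulAction G X]
    (x₀ : X) (R : ℝ) (x : X) : ℝ :=
  max 0 (min 1 (2 - infDist x (MulAction.orbit G x₀) / R))

/-- The cutoff is Lipschitz with constant 1/R and varies only where the distance to the orbit lies
in [R, 2R]; the band is widened by `r` because `y` may be that far from `x`. -/
lemma orbitCutoff_le (x₀ : X) {R r : ℝ} (hR : 0 < R) (hr : 0 ≤ r) {x y : X}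
    (hxy : dist y x < r) :
    orbitCutoff G x₀ R y ≤ orbitCutoff G x₀ R x +
      if R - r ≤ infDist x (MulAction.orbit G x₀) ∧
        infDist x (MulAction.orbit G x₀) ≤ 2 * R + r then r / R else 0 := by
  have h1 : infDist x (MulAction.orbit G x₀) ≤ infDist y (MulAction.orbit G x₀) + dist x y :=
    infDist_le_infDist_add_dist
  have h2 : infDist y (MulAction.orbit G x₀) ≤ infDist x (MulAction.orbit G x₀) + dist y x :=
    infDist_le_infDist_add_dist
  rw [dist_comm x y] at h1
  unfold orbitCutoff
  set a := infDist x (MulAction.orbit G x₀)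
  set b := infDist y (MulAction.orbit G x₀)
  by_cases hx : R - r ≤ a ∧ a ≤ 2 * R + r
  · rw [if_pos hx]
    have h0 : 0 ≤ r / R := by positivity
    have h3 : 2 - b / R ≤ 2 - a / R + r / R := by
      have : a / R ≤ (b + r) / R := by gcongr; linarith
      rw [add_div] at this
      linarith
    rcases max_cases 0 (min 1 (2 - b / R)) with h | h <;>
    rcases max_cases 0 (min 1 (2 - a / R)) with h' | h' <;>
    rcases min_cases 1 (2 - b / R) with h'' | h'' <;>
    rcases min_cases 1 (2 - a / R) with h''' | h''' <;> linarith
  · rw [if_neg hx, add_zero]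
    rw [not_and_or, not_le, not_le] at hx
    rcases hx with hx | hx
    · have : a / R ≤ 1 := by rw [div_le_one hR]; linarith
      rw [min_eq_left (by linarith : 1 ≤ 2 - a / R)]
      simp
    · have : 2 ≤ b / R := by rw [le_div_iff₀ hR]; linarith
      rw [max_eq_left ((min_le_right _ _).trans (by linarith))]
      simp

variable [MeasurableSpace X] [BorelSpace X] {μ : Measure X} [SFinite μ] [Countable G]
  [IsIsometricSMul G X] [SMulInvariantMeasure G X μ]

/-- The double integral of an invariant kernel over a fundamental domain in the first variable
agrees with the one over a fundamental domain in the second variable. -/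
lemma lintegral_fundamentalDomain_swap {F : Set X} (hF : IsFundamentalDomain G F μ)
    {K : X → X → ℝ≥0∞} (hK : Measurable (Function.uncurry K))
    (hinv : ∀ (g : G) x y, K (g • x) (g • y) = K x y) :
    ∫⁻ x in F, ∫⁻ y, K x y ∂μ ∂μ = ∫⁻ x in F, ∫⁻ y, K y x ∂μ ∂μ := by
  have hK1 (x : X) : Measurable (K x) := hK.comp measurable_prodMk_left
  have hg (g : G) : Measurable (fun x : X => g • x) := (isometry_smul X g).continuous.measurable
  -- Unfold the inner integral into translates of `F`, move each group element to the other variable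
  -- by invariance of the kernel, and fold again.
  calc ∫⁻ x in F, ∫⁻ y, K x y ∂μ ∂μ
      = ∫⁻ x in F, ∑' g : G, ∫⁻ y in F, K x (g • y) ∂μ ∂μ := by
        simp_rw [fun x => hF.lintegral_eq_tsum'' (K x)]
    _ = ∑' g : G, ∫⁻ x in F, ∫⁻ y in F, K x (g • y) ∂μ ∂μ := by
        refine lintegral_tsum fun g => Measurable.aemeasurable ?_
        have : Measurable (Function.uncurry fun x y => K x (g • y)) :=
          hK.comp (measurable_fst.prodMk ((hg g).comp measurable_snd))
        exact this.lintegral_prod_right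
    _ = ∑' g : G, ∫⁻ x in F, ∫⁻ y in F, K (g⁻¹ • x) y ∂μ ∂μ := by
        refine tsum_congr fun g => ?_
        refine lintegral_congr fun x => lintegral_congr fun y => ?_
        rw [← hinv g⁻¹, inv_smul_smul]
    _ = ∑' g : G, ∫⁻ y in F, ∫⁻ x in F, K (g⁻¹ • x) y ∂μ ∂μ := by
        refine tsum_congr fun g => lintegral_lintegral_swap (Measurable.aemeasurable ?_)
        exact hK.comp (((hg g⁻¹).comp measurable_fst).prodMk measurable_snd)
    _ = ∫⁻ y in F, ∑' g : G, ∫⁻ x in F, K (g⁻¹ • x) y ∂μ ∂μ := by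
        refine (lintegral_tsum fun g => Measurable.aemeasurable ?_).symm
        have : Measurable (Function.uncurry fun y x => K (g⁻¹ • x) y) :=
          hK.comp (((hg g⁻¹).comp measurable_snd).prodMk measurable_fst)
        exact this.lintegral_prod_right
    _ = ∫⁻ x in F, ∫⁻ y, K y x ∂μ ∂μ := by
        refine lintegral_congr fun x => ?_
        rw [hF.lintegral_eq_tsum']

variable [SecondCountableTopology X]

/-- Averaging over balls of a fixed radius is a symmetric operator on the quotient. -/
lemma lintegral_mul_ball_symm {F : Set X} (hF : IsFundamentalDomain G F μ) (r : ℝ)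
    {χ v : X → ℝ≥0∞} (hχ : Measurable χ) (hv : Measurable v)
    (hχG : ∀ (g : G) x, χ (g • x) = χ x) (hvG : ∀ (g : G) x, v (g • x) = v x) :
    ∫⁻ x in F, χ x * ∫⁻ y in ball x r, v y ∂μ ∂μ =
      ∫⁻ x in F, v x * ∫⁻ y in ball x r, χ y ∂μ ∂μ := by
  have key := lintegral_fundamentalDomain_swap hF
    (K := fun x y => {p : X × X | dist p.2 p.1 < r}.indicator (fun p => χ p.1 * v p.2) (x, y))
    (by
      refine Measurable.indicator (by fun_prop) ?_
      exact measurableSet_lt (measurable_snd.dist measurable_fst) measurable_const)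
    (fun g x y => by simp [Set.indicator_apply, dist_smul, hχG, hvG])
  convert key using 1
  · refine lintegral_congr fun x => ?_
    rw [← lintegral_const_mul _ hv, ← lintegral_indicator measurableSet_ball]
    refine lintegral_congr fun y => ?_
    by_cases h : dist y x < r <;> simp [h]
  · refine lintegral_congr fun x => ?_
    rw [← lintegral_const_mul _ hχ, ← lintegral_indicator measurableSet_ball]
    refine lintegral_congr fun y => ?_
    by_cases h : dist y x < r <;> simp [h, dist_comm x y, mul_comm]

/-- A nonnegative invariant function of at most linear growth that is bounded by its averages over
balls of radius `r` is almost everywhere equal to them, if the quotient has finite volume. -/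
theorem ae_eq_lintegral_ball {F : Set X} (hF : IsFundamentalDomain G F μ) (hFfin : μ F < ⊤)
    {r : ℝ} (hr : 0 < r) {V : ℝ≥0∞} (hV : ∀ x, μ (ball x r) = V) (hVtop : V ≠ ⊤)
    {v : X → ℝ≥0∞} (hv : Measurable v) (hvG : ∀ (g : G) x, v (g • x) = v x) (x₀ : X)
    {a b : ℝ} (hb : 0 ≤ b)
    (hgrowth : ∀ x, v x ≤ ENNReal.ofReal (a + b * infDist x (MulAction.orbit G x₀)))
    (hsub : ∀ x, V * v x ≤ ∫⁻ y in ball x r, v y ∂μ) :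
    ∀ᵐ x ∂μ, ∫⁻ y in ball x r, v y ∂μ = V * v x := by
  set ρ : X → ℝ := fun x => infDist x (MulAction.orbit G x₀) with hρ
  have hρm : Measurable ρ := (continuous_infDist_pt _).measurable
  set S : ℝ → Set X := fun R => {x | R - r ≤ ρ x ∧ ρ x ≤ 2 * R + r} with hS
  have hSm (R : ℝ) : MeasurableSet (S R) :=
    (measurableSet_le measurable_const hρm).inter (measurableSet_le hρm measurable_const)
  set χ : ℝ → X → ℝ≥0∞ := fun R x => ENNReal.ofReal (orbitCutoff G x₀ R x) with hχ
  have hχm (R : ℝ) : Measurable (χ R) := by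
    unfold χ orbitCutoff
    fun_prop
  have hχG (R : ℝ) (g : G) (x : X) : χ R (g • x) = χ R x := by
    simp only [hχ, orbitCutoff, infDist_orbit_smul]
  have hA : Measurable fun x => ∫⁻ y in ball x r, v y ∂μ := by
    have : Measurable (Function.uncurry fun x y =>
        {p : X × X | dist p.2 p.1 < r}.indicator (fun p => v p.2) (x, y)) := by
      refine Measurable.indicator (by fun_prop) ?_
      exact measurableSet_lt (measurable_snd.dist measurable_fst) measurable_const
    have h2 := this.lintegral_prod_right' (ν := μ)
    have h3 : (fun x => ∫⁻ y in ball x r, v y ∂μ) = fun x => ∫⁻ y,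
        Function.uncurry (fun x y =>
          {p : X × X | dist p.2 p.1 < r}.indicator (fun p => v p.2) (x, y)) (x, y) ∂μ := by
      ext x
      rw [← lintegral_indicator measurableSet_ball]
      refine lintegral_congr fun y => ?_
      by_cases h : dist y x < r <;> simp [h]
    rw [h3]
    exact h2
  -- The defect in the sub-mean-value inequality. The subtraction is truncated, but `hsub` makes it
  -- a true difference.
  set w : X → ℝ≥0∞ := fun x => (∫⁻ y in ball x r, v y ∂μ) - V * v x with hw
  have hwm : Measurable w := hA.sub (hv.const_mul V)
  have hwG (g : G) (x : X) : w (g • x) = w x := by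
    have : ∫⁻ y in ball (g • x) r, v y ∂μ = ∫⁻ y in ball x r, v y ∂μ := by
      rw [← (measurePreserving_smul g μ).setLIntegral_comp_preimage measurableSet_ball hv]
      simp_rw [hvG]
      congr 2
      ext y
      simp [mem_ball]
    simp only [hw, hvG, this]
  -- the estimate for a single cutoff function
  have hest (R : ℝ) (hR : 0 < R) : ∫⁻ x in F, χ R x * w x ∂μ ≤
      V * ENNReal.ofReal (r / R * (a + b * (2 * R + r))) * μ (F ∩ {x | R - r ≤ ρ x}) := by
    -- Finiteness, due to the cutoff, is what allows this term to be cancelled at the end.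
    have hfin : ∫⁻ x in F, χ R x * (V * v x) ∂μ ≠ ⊤ := by
      have : ∀ x, χ R x * (V * v x) ≤ V * ENNReal.ofReal (a + b * (2 * R)) := by
        intro x
        by_cases hx : ρ x ≤ 2 * R
        · calc χ R x * (V * v x) ≤ 1 * (V * ENNReal.ofReal (a + b * (2 * R))) := by
                gcongr
                · simp [hχ, orbitCutoff]
                · refine (hgrowth x).trans ?_
                  gcongr
            _ = _ := one_mul _
        · have : χ R x = 0 := by
            have h2 : 2 ≤ ρ x / R := by rw [le_div_iff₀ hR]; linarith
            simp only [hχ, orbitCutoff]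
            rw [max_eq_left ((min_le_right _ _).trans (by linarith))]
            simp
          simp [this]
      refine ((lintegral_mono this).trans_lt ?_).ne
      rw [lintegral_const, Measure.restrict_apply_univ]
      exact ENNReal.mul_lt_top (ENNReal.mul_lt_top hVtop.lt_top ENNReal.ofReal_lt_top) hFfin
    have hsum : ∫⁻ x in F, χ R x * (V * v x) ∂μ + ∫⁻ x in F, χ R x * w x ∂μ =
        ∫⁻ x in F, χ R x * ∫⁻ y in ball x r, v y ∂μ ∂μ := by
      rw [← lintegral_add_left (f := fun x => χ R x * (V * v x))
        ((hχm R).mul (hv.const_mul V))]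
      refine lintegral_congr fun x => ?_
      rw [← mul_add, hw, add_tsub_cancel_of_le (hsub x)]
    have hball (x : X) : ∫⁻ y in ball x r, χ R y ∂μ ≤
        V * χ R x + (S R).indicator (fun _ => V * ENNReal.ofReal (r / R)) x := by
      calc ∫⁻ y in ball x r, χ R y ∂μ
          ≤ ∫⁻ y in ball x r, (χ R x +
              (S R).indicator (fun _ => ENNReal.ofReal (r / R)) x) ∂μ := by
            refine setLIntegral_mono measurable_const fun y hy => ?_
            refine (ENNReal.ofReal_le_ofReal (orbitCutoff_le x₀ hR hr.le hy)).trans ?_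
            refine ENNReal.ofReal_add_le.trans (add_le_add le_rfl ?_)
            by_cases hx : x ∈ S R
            · rw [Set.indicator_of_mem hx, if_pos ⟨hx.1, hx.2⟩]
            · rw [Set.indicator_of_notMem hx, if_neg fun h => hx ⟨h.1, h.2⟩, ENNReal.ofReal_zero]
        _ = _ := by
            rw [lintegral_const, Measure.restrict_apply_univ, hV, add_mul, mul_comm]
            simp only [Set.indicator_apply]
            split_ifs <;> simp [mul_comm]
    have hmain : ∫⁻ x in F, χ R x * (V * v x) ∂μ + ∫⁻ x in F, χ R x * w x ∂μ ≤
        ∫⁻ x in F, χ R x * (V * v x) ∂μ +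
          V * ENNReal.ofReal (r / R * (a + b * (2 * R + r))) * μ (F ∩ {x | R - r ≤ ρ x}) := by
      -- Symmetry moves the averaging from `v` to the cutoff, whose average exceeds V χ by at most V
      -- r/R, and only on the band `S R`, where `v` is at most a + b(2R + r).
      rw [hsum, lintegral_mul_ball_symm hF r (hχm R) hv (hχG R) hvG]
      calc ∫⁻ x in F, v x * ∫⁻ y in ball x r, χ R y ∂μ ∂μ
          ≤ ∫⁻ x in F, (χ R x * (V * v x) + {x | R - r ≤ ρ x}.indicator
              (fun _ => V * ENNReal.ofReal (r / R * (a + b * (2 * R + r)))) x) ∂μ := by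
            refine lintegral_mono fun x => ?_
            refine (mul_le_mul_right (hball x) (v x)).trans ?_
            rw [mul_add]
            refine add_le_add (by rw [mul_left_comm, mul_comm (v x), mul_left_comm]) ?_
            by_cases hx : x ∈ S R
            · rw [Set.indicator_of_mem hx,
                Set.indicator_of_mem (show x ∈ {x | R - r ≤ ρ x} from hx.1),
                ENNReal.ofReal_mul (by positivity), mul_comm (v x), mul_assoc]
              gcongr
              refine (hgrowth x).trans ?_
              gcongr
              exact hx.2
            · rw [Set.indicator_of_notMem hx]
              simp
        _ = _ := by
            have hm : MeasurableSet {x | R - r ≤ ρ x} := measurableSet_le measurable_const hρm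
            rw [lintegral_add_left (f := fun x => χ R x * (V * v x))
                ((hχm R).mul (hv.const_mul V)),
              lintegral_indicator hm, lintegral_const, Measure.restrict_apply_univ,
              Measure.restrict_apply hm, Set.inter_comm]
    exact (ENNReal.add_le_add_iff_left hfin).mp hmain
  -- The linear growth of `v` is just compensated by the factor 1/R, so the coefficient stays
  -- bounded while the far part of `F` loses all its measure.
  have hlim : Tendsto (fun n : ℕ => V * ENNReal.ofReal (r / (n + 1 : ℝ) *
      (a + b * (2 * (n + 1 : ℝ) + r))) * μ (F ∩ {x | (n + 1 : ℝ) - r ≤ ρ x})) atTop (𝓝 0) := by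
    have h1 : Tendsto (fun n : ℕ => μ (F ∩ {x | (n + 1 : ℝ) - r ≤ ρ x})) atTop (𝓝 0) := by
      have hint : ⋂ n : ℕ, (F ∩ {x | (n + 1 : ℝ) - r ≤ ρ x}) = ∅ := by
        ext x
        simp only [Set.mem_iInter, Set.mem_inter_iff, Set.mem_ofPred_eq, Set.mem_empty_iff_false,
          iff_false, not_forall]
        obtain ⟨n, hn⟩ := exists_nat_gt (ρ x + r)
        exact ⟨n, fun h => by linarith [h.2]⟩
      rw [← measure_empty (μ := μ), ← hint]
      refine tendsto_measure_iInter_atTop (fun n => hF.nullMeasurableSet.inter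
        (measurableSet_le measurable_const hρm).nullMeasurableSet) ?_
        ⟨0, (measure_mono Set.inter_subset_left |>.trans_lt hFfin).ne⟩
      intro m n hmn x hx
      refine ⟨hx.1, ?_⟩
      have h1 : (n + 1 : ℝ) - r ≤ ρ x := hx.2
      have h2 : (m + 1 : ℝ) - r ≤ ρ x := by
        have : (m : ℝ) ≤ n := by exact_mod_cast hmn
        linarith
      exact h2
    refine tendsto_of_tendsto_of_tendsto_of_le_of_le tendsto_const_nhds (h := fun n : ℕ =>
      V * ENNReal.ofReal (r * (|a| + b * (2 + r))) * μ (F ∩ {x | (n + 1 : ℝ) - r ≤ ρ x})) ?_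
      (fun _ => zero_le) fun n => ?_
    · have := ENNReal.Tendsto.const_mul h1 (a := V * ENNReal.ofReal (r * (|a| + b * (2 + r))))
        (Or.inr (ENNReal.mul_ne_top hVtop ENNReal.ofReal_ne_top))
      simpa using this
    · dsimp only
      refine mul_le_mul_left (mul_le_mul_right (ENNReal.ofReal_le_ofReal ?_) _) _
      have hn : (1 : ℝ) ≤ n + 1 := by linarith [(Nat.cast_nonneg n : (0 : ℝ) ≤ n)]
      rw [div_mul_eq_mul_div, div_le_iff₀ (by linarith), mul_assoc]
      refine mul_le_mul_of_nonneg_left ?_ hr.le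
      have h1 : a ≤ |a| * (n + 1 : ℝ) :=
        (le_abs_self a).trans (le_mul_of_one_le_right (abs_nonneg a) hn)
      nlinarith [mul_nonneg hb hr.le, mul_nonneg (mul_nonneg hb hr.le) (sub_nonneg.mpr hn)]
  have hzero : ∫⁻ x in F, w x ∂μ = 0 := by
    refine le_antisymm ?_ zero_le
    calc ∫⁻ x in F, w x ∂μ
        -- Fatou's lemma: the cutoffs are eventually 1 at each point.
        ≤ ∫⁻ x in F, liminf (fun n : ℕ => χ (n + 1 : ℝ) x * w x) atTop ∂μ := by
          refine lintegral_mono fun x => ?_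
          refine le_of_eq (Tendsto.liminf_eq (tendsto_const_nhds.congr' ?_)).symm
          obtain ⟨n, hn⟩ := exists_nat_gt (ρ x)
          filter_upwards [eventually_ge_atTop n] with m hm
          have hm' : (n : ℝ) ≤ m := by exact_mod_cast hm
          have : ρ x / (m + 1 : ℝ) ≤ 1 := by
            rw [div_le_one (by positivity)]; linarith
          simp only [hχ, orbitCutoff]
          rw [min_eq_left (by linarith : 1 ≤ 2 - ρ x / (m + 1 : ℝ))]
          simp
      _ ≤ liminf (fun n : ℕ => ∫⁻ x in F, χ (n + 1 : ℝ) x * w x ∂μ) atTop :=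
          lintegral_liminf_le fun n => (hχm _).mul hwm
      _ ≤ liminf (fun n : ℕ => V * ENNReal.ofReal (r / (n + 1 : ℝ) *
            (a + b * (2 * (n + 1 : ℝ) + r))) * μ (F ∩ {x | (n + 1 : ℝ) - r ≤ ρ x})) atTop :=
          liminf_le_liminf (Eventually.of_forall fun n => hest _ (by positivity))
      _ = 0 := hlim.liminf_eq
  have hall : ∫⁻ x, w x ∂μ = 0 := by
    rw [hF.lintegral_eq_tsum'']
    simp [hwG, hzero]
  filter_upwards [(lintegral_eq_zero_iff hwm).mp hall] with x hx
  exact le_antisymm (tsub_eq_zero_iff_le.mp hx) (hsub x)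

end Averaging

/-! ### The Möbius action, its cocycle and the invariant measure -/

section Moebius

lemma cocycle_ne_zero (g : SL(2, ℝ)) (z : ℍ) : cocycle g z ≠ 0 := by
  simpa [denom, cocycle] using denom_ne_zero (g : GL (Fin 2) ℝ) z

lemma coe_smul_eq (g : SL(2, ℝ)) (z : ℍ) :
    ((g • z : ℍ) : ℂ) = ((g 0 0 : ℂ) * z + g 0 1) / cocycle g z := by
  rw [coe_specialLinearGroup_apply]
  simp [cocycle]

lemma cocycle_mul (g h : SL(2, ℝ)) (z : ℍ) :
    cocycle (g * h) z = cocycle g (h • z) * cocycle h z := by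
  have h0 := cocycle_ne_zero h z
  have e : cocycle g (h • z) = (g 1 0 : ℂ) * ((h • z : ℍ) : ℂ) + g 1 1 := rfl
  rw [e, coe_smul_eq]
  field_simp
  simp only [cocycle, Matrix.SpecialLinearGroup.coe_mul, Matrix.mul_apply, Fin.sum_univ_two]
  push_cast
  ring

lemma det_eq (g : SL(2, ℝ)) : g 0 0 * g 1 1 - g 0 1 * g 1 0 = 1 := by
  have := g.det_coe
  rwa [Matrix.det_fin_two] at this

lemma im_smul_eq (g : SL(2, ℝ)) (z : ℍ) : (g • z).im = z.im / ‖cocycle g z‖ ^ 2 := by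
  have h := im_smul_eq_div_normSq (g : GL (Fin 2) ℝ) z
  rw [show (Matrix.GeneralLinearGroup.det (g : GL (Fin 2) ℝ) : ℝ) = 1 by simp] at h
  rw [abs_one, one_mul, Complex.normSq_eq_norm_sq] at h
  exact h

instance : MeasureTheory.SMulInvariantMeasure SL(2, ℝ) ℍ MeasureTheory.volume where
  measure_preimage_smul g _ hs :=
    MeasureTheory.SMulInvariantMeasure.measure_preimage_smul (g : GL (Fin 2) ℝ) hs

/-- The density y^(-2) is positive. This upgrades almost everywhere identities between continuous
functions to identities. -/
instance : MeasureTheory.Measure.IsOpenPosMeasure (MeasureTheory.volume : MeasureTheory.Measure ℍ) where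
  open_pos U hU hne h0 := by
    rw [volume_eq_lintegral, MeasureTheory.setLIntegral_eq_zero_iff] at h0
    · have hopen : IsOpen (UpperHalfPlane.coe '' U) := isOpenEmbedding_coe.isOpenMap U hU
      refine (hopen.measure_pos MeasureTheory.volume (hne.image _)).ne' ?_
      refine MeasureTheory.measure_mono_null ?_ h0
      rintro _ ⟨z, hz, rfl⟩
      have := z.im_pos.ne'
      simp [hz, this]
    · exact (isOpenEmbedding_coe.isOpenMap U hU).measurableSet
    · fun_prop

lemma exists_sl2_smul_eq (γ : PSL(2, ℝ)) : ∃ g : SL(2, ℝ), (g : PSL(2, ℝ)) = γ :=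
  QuotientGroup.mk_surjective γ

instance : IsIsometricSMul PSL(2, ℝ) ℍ where
  isometry_smul γ := by
    obtain ⟨g, rfl⟩ := exists_sl2_smul_eq γ
    exact isometry_smul ℍ g

instance : MeasureTheory.SMulInvariantMeasure PSL(2, ℝ) ℍ MeasureTheory.volume where
  measure_preimage_smul γ s hs := by
    obtain ⟨g, rfl⟩ := exists_sl2_smul_eq γ
    exact MeasureTheory.SMulInvariantMeasure.measure_preimage_smul g hs

/-- A discrete subspace of a second countable space is countable. Discreteness of `Γ` enters the
theorem only through this. -/
lemma countable_of_discreteTopology (Γ : Subgroup PSL(2, ℝ)) [DiscreteTopology Γ] :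
    Countable Γ := by
  have : SecondCountableTopology SL(2, ℝ) :=
    by
    have : SecondCountableTopology (Matrix (Fin 2) (Fin 2) ℝ) :=
      inferInstanceAs (SecondCountableTopology (Fin 2 → Fin 2 → ℝ))
    exact TopologicalSpace.Subtype.secondCountableTopology _
  have : SecondCountableTopology PSL(2, ℝ) :=
    inferInstanceAs (SecondCountableTopology (SL(2, ℝ) ⧸ Subgroup.center SL(2, ℝ)))
  exact TopologicalSpace.separableSpace_iff_countable.mp inferInstance

end Moebius

/-! ### The disc model and rotations about `I` -/

section Cayley

/-- The Cayley transform from the upper half-plane to the unit disc. -/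
def cayley (z : ℍ) : ℂ := ((z : ℂ) - Complex.I) / (z + Complex.I)

lemma coe_add_I_ne_zero (z : ℍ) : (z : ℂ) + Complex.I ≠ 0 := by
  intro h
  have := congrArg Complex.im h
  simp at this
  linarith [z.im_pos]

lemma one_sub_cayley (z : ℍ) : 1 - cayley z = 2 * Complex.I / (z + Complex.I) := by
  have := coe_add_I_ne_zero z
  unfold cayley
  field_simp
  ring

lemma one_sub_norm_cayley_sq (z : ℍ) :
    1 - ‖cayley z‖ ^ 2 = 4 * z.im / ‖(z : ℂ) + Complex.I‖ ^ 2 := by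
  have h0 : ‖(z : ℂ) + Complex.I‖ ^ 2 ≠ 0 := by
    have := coe_add_I_ne_zero z
    positivity
  rw [cayley, norm_div, div_pow, eq_div_iff h0, sub_mul, div_mul_cancel₀ _ h0, one_mul]
  rw [← Complex.normSq_eq_norm_sq, ← Complex.normSq_eq_norm_sq]
  simp [Complex.normSq_apply]
  ring

lemma norm_cayley_lt_one (z : ℍ) : ‖cayley z‖ < 1 := by
  have h := one_sub_norm_cayley_sq z
  have : 0 < 4 * z.im / ‖(z : ℂ) + Complex.I‖ ^ 2 := by
    have := coe_add_I_ne_zero z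
    have := z.im_pos
    positivity
  nlinarith [norm_nonneg (cayley z)]

/-- The inverse of the Cayley transform. -/
def cayleyInv (ζ : ℂ) : ℂ := Complex.I * (1 + ζ) / (1 - ζ)

lemma one_sub_ne_zero_of_mem_ball {ζ : ℂ} (h : ζ ∈ Metric.ball (0 : ℂ) 1) : 1 - ζ ≠ 0 := by
  rintro h0
  rw [sub_eq_zero] at h0
  rw [← h0] at h
  simp at h

lemma cayleyInv_im_pos {ζ : ℂ} (h : ζ ∈ Metric.ball (0 : ℂ) 1) : 0 < (cayleyInv ζ).im := by
  have h1 := one_sub_ne_zero_of_mem_ball h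
  have h2 : 0 < Complex.normSq (1 - ζ) := Complex.normSq_pos.mpr h1
  have h3 : ‖ζ‖ ^ 2 < 1 := by
    have : ‖ζ‖ < 1 := by simpa using h
    nlinarith [norm_nonneg ζ]
  rw [← Complex.normSq_eq_norm_sq, Complex.normSq_apply] at h3
  have : (cayleyInv ζ).im = (1 - (ζ.re * ζ.re + ζ.im * ζ.im)) / Complex.normSq (1 - ζ) := by
    rw [cayleyInv, Complex.div_im]
    simp
    field_simp
    ring
  rw [this]
  exact div_pos (by linarith) h2

lemma cayleyInv_cayley (z : ℍ) : cayleyInv (cayley z) = z := by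
  have := coe_add_I_ne_zero z
  rw [cayleyInv, one_sub_cayley, cayley]
  field_simp
  ring

lemma cayley_ofComplex_cayleyInv {ζ : ℂ} (h : ζ ∈ Metric.ball (0 : ℂ) 1) :
    cayley (ofComplex (cayleyInv ζ)) = ζ := by
  have h1 := one_sub_ne_zero_of_mem_ball h
  rw [cayley, ofComplex_apply_of_im_pos (cayleyInv_im_pos h)]
  simp only [cayleyInv]
  rw [div_eq_iff]
  · field_simp
    ring
  · field_simp
    ring_nf
    simpa using h1

/-- Rotation around `I`. -/
def rotation (t : ℝ) : SL(2, ℝ) :=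
  ⟨!![Real.cos (t / 2), Real.sin (t / 2); -Real.sin (t / 2), Real.cos (t / 2)], by
    rw [Matrix.det_fin_two_of]
    nlinarith [Real.sin_sq_add_cos_sq (t / 2)]⟩

lemma continuous_rotation : Continuous rotation := by
  refine Continuous.subtype_mk ?_ _
  refine continuous_matrix fun i j => ?_
  fin_cases i <;> fin_cases j <;> simp <;> fun_prop

/-- With c, s the cosine and sine of t/2, the multiplier is (c + si)/(c - si) = (c + si)² = e^(it);
hence the half angle in `rotation`. -/
lemma cayley_rotation_smul (t : ℝ) (z : ℍ) :
    cayley (rotation t • z) = circleMap 0 1 t * cayley z := by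
  have h1 := coe_add_I_ne_zero z
  have h2 := coe_add_I_ne_zero (rotation t • z)
  have h3 := cocycle_ne_zero (rotation t) z
  have hI := Complex.I_sq
  have hexp : circleMap 0 1 t = (Complex.cos ((t : ℂ) / 2) + Complex.sin ((t : ℂ) / 2) * Complex.I) ^ 2 := by
    rw [circleMap, ← Complex.exp_mul_I, ← Complex.exp_nat_mul]
    simp
    ring_nf
  have hone := Complex.sin_sq_add_cos_sq ((t : ℂ) / 2)
  unfold cayley
  rw [coe_smul_eq] at h2 ⊢
  rw [hexp]
  simp only [rotation, cocycle, Matrix.SpecialLinearGroup.coe_mk, Matrix.of_apply, Matrix.cons_val',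
    Matrix.cons_val_zero, Matrix.cons_val_one, Matrix.cons_val_fin_one, Complex.ofReal_neg,
    Complex.ofReal_cos, Complex.ofReal_sin, Complex.ofReal_div, Complex.ofReal_ofNat] at h2 h3 ⊢
  set c := Complex.cos ((t : ℂ) / 2)
  set s := Complex.sin ((t : ℂ) / 2)
  have e1 : (c * z + s) / (-s * z + c) - Complex.I =
      (c + s * Complex.I) * (z - Complex.I) / (-s * z + c) := by
    rw [eq_div_iff h3, sub_mul, div_mul_cancel₀ _ h3]
    linear_combination s * hI
  have e2 : (c * z + s) / (-s * z + c) + Complex.I =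
      (c - s * Complex.I) * (z + Complex.I) / (-s * z + c) := by
    rw [eq_div_iff h3, add_mul, div_mul_cancel₀ _ h3]
    linear_combination s * hI
  have e3 : (c + s * Complex.I) * (c - s * Complex.I) = 1 := by
    linear_combination hone - s ^ 2 * hI
  have e4 : c - s * Complex.I ≠ 0 := right_ne_zero_of_mul (e3 ▸ one_ne_zero)
  rw [e1, e2, div_div_div_cancel_right₀ h3, ← mul_div_assoc, div_eq_div_iff
    (mul_ne_zero e4 h1) h1]
  linear_combination -(c + s * Complex.I) * (z - Complex.I) * (z + Complex.I) * e3

end Cayley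

/-! ### Holomorphy of translates and cocycles -/

section Holomorphy

lemma mdifferentiable_comp_smul {f : ℍ → ℂ} (hf : MDiff f) (g : SL(2, ℝ)) :
    MDiff (fun z : ℍ => f (g • z)) := by
  have : MDiff (fun z : ℍ => (g : GL (Fin 2) ℝ) • z) := mdifferentiable_smul (by simp)
  exact hf.comp this

lemma mdifferentiable_cocycle (g : SL(2, ℝ)) : MDiff (cocycle g) :=
  mdifferentiable_denom (g : GL (Fin 2) ℝ)

end Holomorphy

/-! ### The sub-mean-value inequality for the invariant norm -/

section SubMeanValue

open MeasureTheory Metric Real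
open scoped ENNReal

/-- By Jensen's formula the circle average of log|H| exceeds log|H(0)| by a sum of terms log(1/|u|)
≥ 0 over the zeros u in the disc. -/
lemma posLog_norm_le_circleAverage {H : ℂ → ℂ} (hH : AnalyticOnNhd ℂ H (closedBall 0 1)) :
    log⁺ ‖H 0‖ ≤ circleAverage (fun x => log⁺ ‖H x‖) 0 1 := by
  have hs : sphere (0 : ℂ) |1| ⊆ closedBall 0 1 := by
    rw [abs_one]; exact sphere_subset_closedBall
  have hmer : MeromorphicOn H (sphere 0 |1|) := (hH.mono hs).meromorphicOn
  rw [posLog_apply]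
  refine max_le ?_ ?_
  · refine circleAverage_nonneg_of_nonneg fun x _ => posLog_nonneg
  · by_cases h0 : H 0 = 0
    · simpa [h0] using circleAverage_nonneg_of_nonneg (c := (0 : ℂ)) (R := 1)
        (f := fun x => log⁺ ‖H x‖) fun x _ => posLog_nonneg
    have hJ := AnalyticOnNhd.circleAverage_log_norm (c := 0) (R := 1) one_ne_zero
      (by simpa using hH) h0
    calc log ‖H 0‖ ≤ circleAverage (fun x => log ‖H x‖) 0 1 := by
          rw [hJ]
          refine le_add_of_nonneg_left (finsum_nonneg fun u => ?_)
          by_cases hu : u ∈ closedBall (0 : ℂ) |1|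
          · refine mul_nonneg ?_ ?_
            · have := MeromorphicOn.AnalyticOnNhd.divisor_nonneg (𝕜 := ℂ) (f := H)
                (U := closedBall 0 |1|) (by simpa using hH)
              exact_mod_cast this u
            · have hu' : ‖u‖ ≤ 1 := by simpa using hu
              rcases eq_or_ne u 0 with rfl | hu0
              · simp
              · refine log_nonneg ?_
                simp only [zero_sub, norm_neg, one_mul]
                exact (one_le_inv₀ (norm_pos_iff.mpr hu0)).mpr hu'
          · rw [Function.locallyFinsuppWithin.apply_eq_zero_of_notMem _ hu]
            simp
      _ ≤ circleAverage (fun x => log⁺ ‖H x‖) 0 1 :=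
          circleAverage_mono hmer.circleIntegrable_log_norm hmer.circleIntegrable_posLog_norm
            fun x _ => le_max_right _ _

/-- The invariant square norm `|f|² y^(-m)` of a form of weight `-m`. -/
def invNormSq (f : ℍ → ℂ) (m : ℕ) (z : ℍ) : ℝ := ‖f z‖ ^ 2 * z.im⁻¹ ^ m

lemma invNormSq_nonneg (f : ℍ → ℂ) (m : ℕ) (z : ℍ) : 0 ≤ invNormSq f m z := by
  have := z.im_pos
  unfold invNormSq
  positivity

lemma continuous_invNormSq {f : ℍ → ℂ} (hf : Continuous f) (m : ℕ) :
    Continuous (invNormSq f m) := by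
  unfold invNormSq
  have : Continuous fun z : ℍ => z.im⁻¹ := continuous_im.inv₀ fun z => z.im_ne_zero
  fun_prop

lemma invNormSq_slash (f : ℍ → ℂ) (m : ℕ) (g : SL(2, ℝ)) (z : ℍ) :
    invNormSq (fun w => cocycle g w ^ m * f (g • w)) m z = invNormSq f m (g • z) := by
  have h := cocycle_ne_zero g z
  simp only [invNormSq, im_smul_eq, norm_mul, norm_pow, inv_div, div_pow, mul_pow, inv_pow]
  have hy := z.im_ne_zero
  field_simp
  ring

/-- At ζ = `cayley z` one has (1 - |ζ|²)/y = |1 - ζ|², so f² (1 - ζ)^(2m) serves as `h`. The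
invariant norm becomes |h| (1 - |ζ|²)^(-m), which brings it within reach of Jensen's formula and the
maximum principle. -/
lemma exists_disc_model {f : ℍ → ℂ} (hf : MDiff f) (m : ℕ) :
    ∃ h : ℂ → ℂ, DifferentiableOn ℂ h (ball 0 1) ∧
      ∀ z, invNormSq f m z * (1 - ‖cayley z‖ ^ 2) ^ m = ‖h (cayley z)‖ := by
  refine ⟨fun ζ => f (ofComplex (cayleyInv ζ)) ^ 2 * (1 - ζ) ^ (2 * m), ?_, fun z => ?_⟩
  · refine DifferentiableOn.mul (DifferentiableOn.pow ?_ 2) (by fun_prop)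
    rw [UpperHalfPlane.mdifferentiable_iff] at hf
    refine DifferentiableOn.comp (g := f ∘ ofComplex) (f := cayleyInv) (t := {z | 0 < z.im}) hf ?_
      fun ζ hζ => cayleyInv_im_pos hζ
    unfold cayleyInv
    refine DifferentiableOn.div (by fun_prop) (by fun_prop) fun ζ hζ => ?_
    exact one_sub_ne_zero_of_mem_ball hζ
  · have h0 := coe_add_I_ne_zero z
    have hy := z.im_ne_zero
    simp only [cayleyInv_cayley, ofComplex_apply, one_sub_cayley, one_sub_norm_cayley_sq,
      invNormSq, norm_mul, norm_pow, norm_div, mul_assoc, pow_mul]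
    congr 1
    rw [← mul_pow]
    congr 1
    simp
    field_simp
    norm_num

/-- Jensen's inequality for `h` on the circle through `cayley w`. The factor (1 - |ζ|²)^m is 1 at
the centre and at most 1 elsewhere; here it matters that the weight -m is not positive. -/
lemma le_lintegral_rotation {f : ℍ → ℂ} (hf : MDiff f) (m : ℕ) (w : ℍ) :
    ENNReal.ofReal (2 * π) * ENNReal.ofReal (log⁺ (invNormSq f m I)) ≤
      ∫⁻ t in Set.Ioc 0 (2 * π), ENNReal.ofReal (log⁺ (invNormSq f m (rotation t • w))) := by
  obtain ⟨h, hh, hfh⟩ := exists_disc_model hf m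
  set H : ℂ → ℂ := fun ξ => h (cayley w * ξ) with hH
  have hHd : DifferentiableOn ℂ H ((fun ξ => cayley w * ξ) ⁻¹' ball 0 1) :=
    hh.comp (by fun_prop) fun ξ hξ => hξ
  have hopen : IsOpen ((fun ξ => cayley w * ξ) ⁻¹' ball (0 : ℂ) 1) :=
    isOpen_ball.preimage (by fun_prop)
  have hHa : AnalyticOnNhd ℂ H (closedBall 0 1) := by
    refine (hHd.analyticOnNhd hopen).mono fun ξ hξ => ?_
    have h1 := norm_cayley_lt_one w
    have h2 : ‖ξ‖ ≤ 1 := by simpa using hξ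
    have : ‖cayley w * ξ‖ < 1 := by
      rw [norm_mul]
      exact (mul_le_of_le_one_right (norm_nonneg _) h2).trans_lt h1
    simpa using this
  have hI : cayley I = 0 := by simp [cayley]
  have h0 : ‖H 0‖ = invNormSq f m I := by
    have := hfh I
    simpa [hI, hH] using this.symm
  have hle (t : ℝ) : ‖H (circleMap 0 1 t)‖ ≤ invNormSq f m (rotation t • w) := by
    have e : cayley w * circleMap 0 1 t = cayley (rotation t • w) := by
      rw [cayley_rotation_smul, mul_comm]
    simp only [hH]
    rw [e, ← hfh]
    refine mul_le_of_le_one_right (invNormSq_nonneg _ _ _) (pow_le_one₀ ?_ ?_)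
    · have := norm_cayley_lt_one (rotation t • w)
      nlinarith [norm_nonneg (cayley (rotation t • w))]
    · have := sq_nonneg ‖cayley (rotation t • w)‖
      linarith
  have hpi : (0 : ℝ) ≤ 2 * π := by positivity
  have hs : sphere (0 : ℂ) |1| ⊆ closedBall 0 1 := by
    rw [abs_one]; exact sphere_subset_closedBall
  have hint : CircleIntegrable (fun x => log⁺ ‖H x‖) 0 1 :=
    (hHa.mono hs).meromorphicOn.circleIntegrable_posLog_norm
  have key := posLog_norm_le_circleAverage hHa
  rw [circleAverage_def, smul_eq_mul, inv_mul_eq_div, le_div_iff₀ (by positivity)] at key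
  rw [← ENNReal.ofReal_mul hpi, ← h0, mul_comm (2 * π)]
  refine (ENNReal.ofReal_le_ofReal key).trans ?_
  rw [intervalIntegral.integral_of_le hpi, ofReal_integral_eq_lintegral_ofReal
    ((intervalIntegrable_iff_integrableOn_Ioc_of_le hpi).mp hint)
    (Filter.Eventually.of_forall fun t => posLog_nonneg)]
  exact lintegral_mono fun t =>
    ENNReal.ofReal_le_ofReal (posLog_le_posLog (norm_nonneg _) (hle t))

lemma rotation_smul_I (t : ℝ) : rotation t • I = I := by
  have h : cayley (rotation t • I) = cayley I := by
    rw [cayley_rotation_smul]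
    simp [cayley]
  have := congrArg cayleyInv h
  rw [cayleyInv_cayley, cayleyInv_cayley] at this
  exact UpperHalfPlane.ext this

lemma setLIntegral_ball_smul {v : ℍ → ℝ≥0∞} (hv : Measurable v) (g : SL(2, ℝ)) (z : ℍ) (r : ℝ) :
    ∫⁻ w in ball (g • z) r, v w = ∫⁻ w in ball z r, v (g • w) := by
  rw [← (measurePreserving_smul g volume).setLIntegral_comp_preimage measurableSet_ball hv]
  congr 2
  ext y
  simp [mem_ball]

lemma volume_ball_smul (g : SL(2, ℝ)) (z : ℍ) (r : ℝ) :
    volume (ball (g • z) r) = volume (ball z r) := by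
  simpa using setLIntegral_ball_smul (v := 1) measurable_one g z r

lemma le_lintegral_ball_I {f : ℍ → ℂ} (hf : MDiff f) (m : ℕ) (r : ℝ) :
    volume (ball I r) * ENNReal.ofReal (log⁺ (invNormSq f m I)) ≤
      ∫⁻ w in ball I r, ENNReal.ofReal (log⁺ (invNormSq f m w)) := by
  set v : ℍ → ℝ≥0∞ := fun w => ENNReal.ofReal (log⁺ (invNormSq f m w)) with hv
  have hvc : Continuous v := by
    have := continuous_invNormSq hf.continuous m
    exact ENNReal.continuous_ofReal.comp (continuous_posLog.comp this)
  have hpi : ENNReal.ofReal (2 * π) ≠ 0 := by simp [pi_pos]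
  -- Integrate the circle inequality over all `w` in the ball and exchange integrals: rotations
  -- preserve both the ball and the measure, so polar coordinates are not needed.
  refine (ENNReal.mul_le_mul_iff_right hpi ENNReal.ofReal_ne_top).mp ?_
  calc ENNReal.ofReal (2 * π) * (volume (ball I r) * v I)
      = ∫⁻ _ in ball I r, ENNReal.ofReal (2 * π) * v I := by
        rw [lintegral_const, Measure.restrict_apply_univ]
        ring
    _ ≤ ∫⁻ w in ball I r, ∫⁻ t in Set.Ioc 0 (2 * π), v (rotation t • w) :=
        lintegral_mono fun w => le_lintegral_rotation hf m w
    _ = ∫⁻ t in Set.Ioc 0 (2 * π), ∫⁻ w in ball I r, v (rotation t • w) := by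
        refine lintegral_lintegral_swap (Measurable.aemeasurable ?_)
        refine hvc.measurable.comp (Continuous.measurable ?_)
        exact (continuous_rotation.comp continuous_snd).smul continuous_fst
    _ = ∫⁻ t in Set.Ioc 0 (2 * π), ∫⁻ w in ball I r, v w := by
        refine lintegral_congr fun t => ?_
        rw [← setLIntegral_ball_smul hvc.measurable, rotation_smul_I]
    _ = ENNReal.ofReal (2 * π) * ∫⁻ w in ball I r, v w := by
        rw [lintegral_const, Measure.restrict_apply_univ, Real.volume_Ioc, sub_zero, mul_comm]

/-- `log⁺ (|f|² y^(-m))` is at most its average over hyperbolic discs. -/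
lemma le_lintegral_ball {f : ℍ → ℂ} (hf : MDiff f) (m : ℕ) (r : ℝ) (z : ℍ) :
    volume (ball I r) * ENNReal.ofReal (log⁺ (invNormSq f m z)) ≤
      ∫⁻ w in ball z r, ENNReal.ofReal (log⁺ (invNormSq f m w)) := by
  have hf' : MDiff (fun w => cocycle (toSL2R z) w ^ m * f (toSL2R z • w)) :=
    ((mdifferentiable_cocycle _).pow m).mul (mdifferentiable_comp_smul hf _)
  have h := le_lintegral_ball_I hf' m r
  simp only [invNormSq_slash] at h
  have hv : Measurable fun w => ENNReal.ofReal (log⁺ (invNormSq f m w)) :=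
    (ENNReal.continuous_ofReal.comp
      (continuous_posLog.comp (continuous_invNormSq hf.continuous m))).measurable
  rwa [← setLIntegral_ball_smul hv, toSL2R_smul_I] at h

end SubMeanValue

/-! ### Modular forms of non-positive weight -/

section Liouville

open MeasureTheory Metric Real Filter Topology
open scoped ENNReal

/-- Moderate growth is thus exponential growth in the hyperbolic distance, and its logarithm is
linear, as the averaging theorem requires. -/
lemma growth_eq_cosh (z : ℍ) : (1 + ‖(z : ℂ)‖ ^ 2) / z.im = 2 * cosh (dist z I) := by
  have hy := z.im_ne_zero
  rw [cosh_dist, Complex.dist_eq, ← Complex.normSq_eq_norm_sq, ← Complex.normSq_eq_norm_sq]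
  simp [Complex.normSq_apply]
  field_simp
  ring

lemma inv_im_le_growth (z : ℍ) : z.im⁻¹ ≤ (1 + ‖(z : ℂ)‖ ^ 2) / z.im := by
  have hy := z.im_pos
  rw [inv_eq_one_div]
  gcongr
  nlinarith [sq_nonneg ‖(z : ℂ)‖]

lemma ModerateGrowth.exists_posLog_le {f : ℍ → ℂ} (hf : ModerateGrowth f) (m : ℕ) :
    ∃ a b : ℝ, 0 < b ∧ ∀ z, log⁺ (invNormSq f m z) ≤ a + b * dist z I := by
  obtain ⟨C, N, hC⟩ := hf
  -- The exponent 2N + m would suffice; the extra 1 keeps the slope positive, so that one can divide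
  -- by it later.
  refine ⟨log⁺ (C ^ 2) + (2 * N + m + 1 : ℕ) * log⁺ 2, (2 * N + m + 1 : ℕ), by positivity,
    fun z => ?_⟩
  set E := (1 + ‖(z : ℂ)‖ ^ 2) / z.im with hE
  have hE1 : 1 ≤ E := one_le_growth z
  have h1 : invNormSq f m z ≤ C ^ 2 * E ^ (2 * N + m) := by
    calc invNormSq f m z ≤ (C * E ^ N) ^ 2 * E ^ m := by
          unfold invNormSq
          have := (inv_pos.mpr z.im_pos).le
          gcongr
          · exact hC z
          · exact inv_im_le_growth z
      _ = _ := by ring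
  have h2 : E ≤ 2 * exp (dist z I) := by
    rw [hE, growth_eq_cosh]
    gcongr
    rw [cosh_eq]
    have : exp (-dist z I) ≤ exp (dist z I) := exp_le_exp.mpr (by linarith [dist_nonneg (x := z) (y := I)])
    linarith
  have h3 : log⁺ E ≤ log⁺ 2 + dist z I := by
    refine (posLog_le_posLog (by positivity) h2).trans (posLog_mul.trans ?_)
    gcongr
    rw [posLog_eq_log]
    · simp
    · rw [abs_of_pos (exp_pos _)]
      exact one_le_exp dist_nonneg
  have h4 : (2 * N + m : ℕ) * log⁺ E ≤ (2 * N + m + 1 : ℕ) * (log⁺ 2 + dist z I) := by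
    have : (0 : ℝ) ≤ log⁺ E := posLog_nonneg
    refine mul_le_mul ?_ h3 this (by positivity)
    push_cast
    linarith
  calc log⁺ (invNormSq f m z) ≤ log⁺ (C ^ 2 * E ^ (2 * N + m)) :=
        posLog_le_posLog (invNormSq_nonneg _ _ _) h1
    _ ≤ log⁺ (C ^ 2) + log⁺ (E ^ (2 * N + m)) := posLog_mul
    _ ≤ _ := by
      rw [posLog_pow (2 * N + m)]
      linarith

variable {Γ : Subgroup PSL(2, ℝ)}

instance : IsIsometricSMul Γ ℍ where
  isometry_smul γ := isometry_smul ℍ (γ : PSL(2, ℝ))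

lemma invNormSq_smul_of_mem {m : ℕ} {f : Hol} (hf : f ∈ modularForms Γ (-(m : ℤ)))
    {g : SL(2, ℝ)} (hg : (g : PSL(2, ℝ)) ∈ Γ) (z : ℍ) :
    invNormSq f m (g • z) = invNormSq f m z := by
  rw [← invNormSq_slash]
  congr 1
  ext w
  have := hf.2 g hg w
  rwa [neg_neg, zpow_natCast] at this

lemma ae_posLog_eq [Countable Γ] (hcov : FiniteCovolume Γ) {m : ℕ} {f : Hol}
    (hf : f ∈ modularForms Γ (-(m : ℤ))) :
    ∀ᵐ x : ℍ, ∫⁻ y in ball x 1, ENNReal.ofReal (log⁺ (invNormSq f m y)) =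
      volume (ball I 1) * ENNReal.ofReal (log⁺ (invNormSq f m x)) := by
  obtain ⟨F, hF, hFfin⟩ := hcov
  obtain ⟨a, b, hb, hab⟩ := hf.1.exists_posLog_le m
  have hinv (γ : Γ) (x : ℍ) : invNormSq f m (γ • x) = invNormSq f m x := by
    obtain ⟨g, hg⟩ := exists_sl2_smul_eq (γ : PSL(2, ℝ))
    have h := invNormSq_smul_of_mem hf (g := g) (hg ▸ γ.2) x
    have e : γ • x = g • x := by
      change (γ : PSL(2, ℝ)) • x = _
      rw [← hg]
      rfl
    rw [e, h]
  have hv : Measurable fun w => ENNReal.ofReal (log⁺ (invNormSq f m w)) :=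
    (ENNReal.continuous_ofReal.comp
      (continuous_posLog.comp (continuous_invNormSq f.2.continuous m))).measurable
  refine ae_eq_lintegral_ball hF hFfin one_pos (V := volume (ball I 1)) (fun x => ?_)
    measure_ball_lt_top.ne hv (fun γ x => by simp only [hinv]) I (a := a) (b := b) hb.le
    (fun x => ENNReal.ofReal_le_ofReal ?_) (fun x => le_lintegral_ball f.2 m 1 x)
  · conv_lhs => rw [← toSL2R_smul_I x]
    exact volume_ball_smul _ _ _
  -- The bound is needed in terms of the distance to the orbit of `I`. By invariance it holds with
  -- `I` replaced by each orbit point, hence for the infimum.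
  · rw [← sub_le_iff_le_add', ← div_le_iff₀' hb]
    refine (le_infDist (MulAction.nonempty_orbit I)).mpr ?_
    rintro _ ⟨γ, rfl⟩
    rw [div_le_iff₀' hb, sub_le_iff_le_add']
    have := hab (γ⁻¹ • x)
    rw [hinv] at this
    refine this.trans_eq ?_
    rw [← dist_smul γ, smul_inv_smul]

lemma invNormSq_const_smul (c : ℂ) (f : ℍ → ℂ) (m : ℕ) (z : ℍ) :
    invNormSq (c • f) m z = ‖c‖ ^ 2 * invNormSq f m z := by
  simp [invNormSq, mul_pow, mul_assoc]

/-- Almost every point is a local maximum of `|f|² y^(-m)`, with a uniform radius. -/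
lemma ae_invNormSq_le [Countable Γ] (hcov : FiniteCovolume Γ) {m : ℕ} {f : Hol}
    (hf : f ∈ modularForms Γ (-(m : ℤ))) :
    ∀ᵐ x : ℍ, ∀ y ∈ ball x 1, invNormSq f m y ≤ invNormSq f m x := by
  have h : ∀ᵐ x : ℍ, ∀ q : ℚ,
      ∫⁻ y in ball x 1, ENNReal.ofReal (log⁺ (invNormSq (((q : ℂ)⁻¹ • f : Hol) : ℍ → ℂ) m y)) =
      volume (ball I 1) *
        ENNReal.ofReal (log⁺ (invNormSq (((q : ℂ)⁻¹ • f : Hol) : ℍ → ℂ) m x)) :=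
    ae_all_iff.mpr fun q => ae_posLog_eq hcov (Submodule.smul_mem _ _ hf)
  filter_upwards [h] with x hx y hy
  by_contra! hlt
  -- With q² strictly between the two values, log⁺ of the norm of f/q vanishes at `x`. So does its
  -- average over the ball, hence by continuity the function itself there, against its value at `y`.
  -- Rational `q` keep the exceptional set null.
  obtain ⟨q, hq1, hq2⟩ := exists_rat_btwn
    (sqrt_lt_sqrt (invNormSq_nonneg _ _ _) hlt)
  have hq0 : (0 : ℝ) < q := (sqrt_nonneg _).trans_lt hq1
  have e (z : ℍ) : invNormSq (((q : ℂ)⁻¹ • f : Hol) : ℍ → ℂ) m z = invNormSq f m z / q ^ 2 := by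
    have : (((q : ℂ)⁻¹ • f : Hol) : ℍ → ℂ) = (q : ℂ)⁻¹ • (f : ℍ → ℂ) := rfl
    rw [this, invNormSq_const_smul, norm_inv, inv_pow, inv_mul_eq_div]
    congr 2
    rw [← Complex.ofReal_ratCast, Complex.norm_real, norm_of_nonneg hq0.le]
  have hcont : Continuous fun z =>
      ENNReal.ofReal (log⁺ (invNormSq (((q : ℂ)⁻¹ • f : Hol) : ℍ → ℂ) m z)) :=
    ENNReal.continuous_ofReal.comp (continuous_posLog.comp
      (continuous_invNormSq (Subtype.prop ((q : ℂ)⁻¹ • f)).continuous m))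
  have h0 : log⁺ (invNormSq (((q : ℂ)⁻¹ • f : Hol) : ℍ → ℂ) m x) = 0 := by
    rw [posLog_eq_zero_iff, abs_of_nonneg (invNormSq_nonneg _ _ _), e, div_le_one (by positivity)]
    exact ((sqrt_lt' hq0).mp hq1).le
  have hx0 := hx q
  rw [h0, ENNReal.ofReal_zero, mul_zero, lintegral_eq_zero_iff hcont.measurable] at hx0
  have hz := Measure.eqOn_open_of_ae_eq hx0 isOpen_ball hcont.continuousOn
    (continuousOn_const (c := (0 : ℝ≥0∞))) hy
  simp only [Pi.zero_apply, ENNReal.ofReal_eq_zero] at hz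
  have hz' := (posLog_eq_zero_iff _).mp (le_antisymm hz posLog_nonneg)
  rw [abs_of_nonneg (invNormSq_nonneg _ _ _), e, div_le_one (by positivity)] at hz'
  exact absurd ((lt_sqrt hq0.le).mp hq2) (not_lt.mpr hz')

/-- Near 0 the maximum gives |h(ζ)| ≤ |h(0)| (1 - |ζ|²)^m, so `h` is locally constant by the maximum
principle; the factor is less than 1 off the centre, which forces h(0) = 0. -/
lemma eq_zero_of_invNormSq_le_I {f : ℍ → ℂ} (hf : MDiff f) {m : ℕ} (hm : m ≠ 0)
    (hmax : ∀ y ∈ ball I 1, invNormSq f m y ≤ invNormSq f m I) : invNormSq f m I = 0 := by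
  obtain ⟨h, hh, hfh⟩ := exists_disc_model hf m
  have hI : cayley I = 0 := by simp [cayley]
  have hI' : cayleyInv 0 = I := by simp [cayleyInv]
  have hh0 : ‖h 0‖ = invNormSq f m I := by
    have := hfh I
    simpa [hI] using this.symm
  have hcont : ContinuousAt (fun ζ => ofComplex (cayleyInv ζ)) 0 := by
    have h1 : ContinuousAt cayleyInv 0 := by
      unfold cayleyInv
      refine ContinuousAt.div (by fun_prop) (by fun_prop) (by simp)
    refine ContinuousAt.comp (g := ofComplex) ?_ h1
    rw [hI']
    exact (contMDiffAt_ofComplex (n := 0) I.im_pos).continuousAt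
  have hev : ∀ᶠ ζ in 𝓝 (0 : ℂ), ζ ∈ ball (0 : ℂ) 1 ∧ ofComplex (cayleyInv ζ) ∈ ball I 1 := by
    refine Filter.Eventually.and (ball_mem_nhds 0 one_pos) (hcont.eventually ?_)
    dsimp only
    rw [hI', ofComplex_apply]
    exact ball_mem_nhds I one_pos
  have hle : ∀ᶠ ζ in 𝓝 (0 : ℂ), ‖h ζ‖ ≤ invNormSq f m I * (1 - ‖ζ‖ ^ 2) ^ m := by
    filter_upwards [hev] with ζ hζ
    have := hfh (ofComplex (cayleyInv ζ))
    rw [cayley_ofComplex_cayleyInv hζ.1] at this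
    rw [← this]
    refine mul_le_mul_of_nonneg_right (hmax _ hζ.2) (pow_nonneg ?_ m)
    have : ‖ζ‖ < 1 := by simpa using hζ.1
    nlinarith [norm_nonneg ζ]
  have hlocal : IsLocalMax (norm ∘ h) 0 := by
    filter_upwards [hle, hev] with ζ hζ hζ'
    simp only [Function.comp_apply, hh0]
    refine hζ.trans (mul_le_of_le_one_right (invNormSq_nonneg _ _ _) (pow_le_one₀ ?_ ?_))
    · have : ‖ζ‖ < 1 := by simpa using hζ'.1
      nlinarith [norm_nonneg ζ]
    · linarith [sq_nonneg ‖ζ‖]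
  have hdiff : ∀ᶠ ζ in 𝓝 (0 : ℂ), DifferentiableAt ℂ h ζ := by
    filter_upwards [isOpen_ball.mem_nhds (mem_ball_self (x := (0 : ℂ)) one_pos)] with ζ hζ
    exact hh.differentiableAt (isOpen_ball.mem_nhds hζ)
  have hconst := Complex.eventually_eq_of_isLocalMax_norm hdiff hlocal
  have hall := hconst.and (hle.and hev)
  obtain ⟨ζ, ⟨h1, h2, h3⟩, hζ⟩ :=
    ((hall.filter_mono nhdsWithin_le_nhds).and (self_mem_nhdsWithin (s := {(0 : ℂ)}ᶜ))).exists
  have hζ0 : 0 < ‖ζ‖ := norm_pos_iff.mpr hζ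
  have hζ1 : ‖ζ‖ < 1 := by simpa using h3.1
  rw [h1, hh0] at h2
  have hpow : (1 - ‖ζ‖ ^ 2) ^ m < 1 := pow_lt_one₀ (by nlinarith) (by nlinarith) hm
  nlinarith [invNormSq_nonneg f m I]

lemma eq_const_of_norm_le {f : ℍ → ℂ} (hf : MDiff f) {x : ℍ}
    (hmax : ∀ y ∈ ball x 1, ‖f y‖ ≤ ‖f x‖) (z : ℍ) : f z = f x := by
  have hof : ContinuousAt ofComplex (x : ℂ) :=
    (contMDiffAt_ofComplex (n := 0) x.im_pos).continuousAt
  have hlocal : IsLocalMax (norm ∘ (f ∘ ofComplex)) (x : ℂ) := by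
    have : ∀ᶠ w in 𝓝 (x : ℂ), ofComplex w ∈ ball x 1 := by
      refine hof.eventually ?_
      rw [ofComplex_apply]
      exact ball_mem_nhds x one_pos
    filter_upwards [this] with w hw
    simpa using hmax _ hw
  have hdiff : ∀ᶠ w in 𝓝 (x : ℂ), DifferentiableAt ℂ (f ∘ ofComplex) w := by
    filter_upwards [isOpen_upperHalfPlaneSet.mem_nhds x.im_pos] with w hw
    exact (UpperHalfPlane.mdifferentiable_iff.mp hf).differentiableAt
      (isOpen_upperHalfPlaneSet.mem_nhds hw)
  have hconst := Complex.eventually_eq_of_isLocalMax_norm hdiff hlocal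
  have hconst' : ∀ᶠ y in 𝓝 x, f y = f x := by
    have := (continuous_coe.continuousAt (x := x)).eventually hconst
    filter_upwards [this] with y hy
    simpa using hy
  have hg : MDiff (fun y => f y - f x) := hf.sub mdifferentiable_const
  have h0 := eq_zero_of_frequently hg (τ := x) (by
    refine (Eventually.frequently ?_)
    filter_upwards [hconst'.filter_mono nhdsWithin_le_nhds] with y hy
    rw [hy, sub_self])
  exact sub_eq_zero.mp (congrFun h0 z)

/-- There are no nonzero modular forms of negative weight. -/
theorem eq_zero_of_mem_modularForms_neg [Countable Γ] (hcov : FiniteCovolume Γ) {k : ℤ}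
    (hk : k < 0) {f : Hol} (hf : f ∈ modularForms Γ k) : f = 0 := by
  obtain ⟨m, rfl⟩ : ∃ m : ℕ, k = -(m : ℤ) := ⟨k.natAbs, by omega⟩
  have hm : m ≠ 0 := by omega
  have hae : (f : ℍ → ℂ) =ᵐ[volume] fun _ => 0 := by
    filter_upwards [ae_invNormSq_le hcov hf] with x hx
    have hf' : MDiff (fun w => cocycle (toSL2R x) w ^ m * (f : ℍ → ℂ) (toSL2R x • w)) :=
      ((mdifferentiable_cocycle _).pow m).mul (mdifferentiable_comp_smul f.2 _)
    have h := eq_zero_of_invNormSq_le_I hf' hm fun y hy => by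
      rw [invNormSq_slash, invNormSq_slash, toSL2R_smul_I]
      refine hx _ ?_
      have : dist (toSL2R x • y) (toSL2R x • I) < 1 := by rwa [dist_smul]
      rwa [toSL2R_smul_I] at this
    rw [invNormSq_slash, toSL2R_smul_I] at h
    have hy := x.im_ne_zero
    simpa [invNormSq, hy] using h
  ext z
  exact congrFun (Continuous.ae_eq_iff_eq volume f.2.continuous continuous_const |>.mp hae) z

/-- Modular forms of weight `0` are constant. -/
theorem eq_const_of_mem_modularForms_zero [Countable Γ] (hcov : FiniteCovolume Γ) {f : Hol}
    (hf : f ∈ modularForms Γ 0) : ∃ c : ℂ, ∀ z, (f : ℍ → ℂ) z = c := by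
  have hae := ae_invNormSq_le hcov (m := 0) (f := f) (by simpa using hf)
  obtain ⟨x, hx⟩ := hae.exists
  refine ⟨_, eq_const_of_norm_le f.2 (x := x) fun y hy => ?_⟩
  have := hx y hy
  simp only [invNormSq, pow_zero, mul_one] at this
  exact (pow_le_pow_iff_left₀ (norm_nonneg _) (norm_nonneg _) two_ne_zero).mp this

end Liouville

/-! ### Vertical dilation and hyperbolic area -/

section Dilation

open MeasureTheory

/-- The map `x + i y ↦ x + i t y`. It commutes with all upper triangular Möbius transformations. -/
def imScale (t : ℝ) (ht : 0 < t) (z : ℍ) : ℍ := ⟨⟨z.re, t * z.im⟩, mul_pos ht z.im_pos⟩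

lemma imScale_smul {t : ℝ} (ht : 0 < t) {g : SL(2, ℝ)} (hg : g 1 0 = 0) (z : ℍ) :
    imScale t ht (g • z) = g • imScale t ht z := by
  have hd : (g 1 1 : ℝ) ≠ 0 := by
    intro h
    have := det_eq g
    simp [hg, h] at this
  have e (w : ℍ) : ((g • w : ℍ) : ℂ) = ((g 0 0 / g 1 1 : ℝ) : ℂ) * w + ((g 0 1 / g 1 1 : ℝ) : ℂ) := by
    rw [coe_smul_eq, cocycle, hg]
    have hd' : (g 1 1 : ℂ) ≠ 0 := by exact_mod_cast hd
    push_cast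
    simp only [zero_mul, zero_add]
    field_simp
  have hre (w : ℍ) : (g • w).re = g 0 0 / g 1 1 * w.re + g 0 1 / g 1 1 := by
    have := congrArg Complex.re (e w)
    rwa [Complex.add_re, Complex.re_ofReal_mul, Complex.ofReal_re] at this
  have him (w : ℍ) : (g • w).im = g 0 0 / g 1 1 * w.im := by
    have := congrArg Complex.im (e w)
    rwa [Complex.add_im, Complex.im_ofReal_mul, Complex.ofReal_im, add_zero] at this
  have hre' (w : ℍ) : (imScale t ht w).re = w.re := rfl
  have him' (w : ℍ) : (imScale t ht w).im = t * w.im := rfl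
  apply UpperHalfPlane.ext
  apply Complex.ext
  · change (imScale t ht (g • z)).re = (g • imScale t ht z).re
    rw [hre', hre, hre, hre']
  · change (imScale t ht (g • z)).im = (g • imScale t ht z).im
    rw [him', him, him, him']
    ring

lemma continuous_imScale {t : ℝ} (ht : 0 < t) : Continuous (imScale t ht) := by
  rw [isOpenEmbedding_coe.isInducing.continuous_iff]
  have : UpperHalfPlane.coe ∘ imScale t ht = fun z => (z.re : ℂ) + (t * z.im : ℝ) * Complex.I := by
    ext z
    apply Complex.ext <;> simp [imScale]
  rw [this]
  have := continuous_re
  have := continuous_im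
  fun_prop

lemma imScale_imScale_inv {t : ℝ} (ht : 0 < t) (z : ℍ) :
    imScale t ht (imScale t⁻¹ (inv_pos.mpr ht) z) = z := by
  apply UpperHalfPlane.ext
  apply Complex.ext
  · rfl
  · change t * (t⁻¹ * z.im) = z.im
    field_simp

lemma imScale_inv_imScale {t : ℝ} (ht : 0 < t) (z : ℍ) :
    imScale t⁻¹ (inv_pos.mpr ht) (imScale t ht z) = z := by
  apply UpperHalfPlane.ext
  apply Complex.ext
  · rfl
  · change t⁻¹ * (t * z.im) = z.im
    field_simp

/-- `imScale t` as a measurable equivalence. -/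
def imScaleEquiv (t : ℝ) (ht : 0 < t) : ℍ ≃ᵐ ℍ where
  toFun := imScale t ht
  invFun := imScale t⁻¹ (inv_pos.mpr ht)
  left_inv := imScale_inv_imScale ht
  right_inv := imScale_imScale_inv ht
  measurable_toFun := (continuous_imScale ht).measurable
  measurable_invFun := (continuous_imScale (inv_pos.mpr ht)).measurable

/-- The linear extension of `imScale` to the complex plane. -/
def imScaleCLM (t : ℝ) : ℂ →L[ℝ] ℂ :=
  Complex.reCLM.smulRight 1 + Complex.imCLM.smulRight (t * Complex.I)

lemma imScaleCLM_apply (t : ℝ) (z : ℂ) : imScaleCLM t z = z.re + z.im * (t * Complex.I) := by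
  simp [imScaleCLM]

lemma det_imScaleCLM (t : ℝ) : (imScaleCLM t).det = t := by
  rw [ContinuousLinearMap.det, ← LinearMap.det_toMatrix Complex.basisOneI, Matrix.det_fin_two]
  simp [LinearMap.toMatrix_apply, imScaleCLM_apply, Complex.coe_basisOneI_repr]

/-- The Jacobian contributes t and the density y^(-2) contributes t^(-2), so images shrink by t and
preimages grow by t. -/
lemma volume_preimage_imScale {t : ℝ} (ht : 0 < t) (s : Set ℍ) :
    volume (imScale t ht ⁻¹' s) = ENNReal.ofReal t * volume s := by
  have key : ∀ s : Set ℍ, MeasurableSet s →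
      volume s = ENNReal.ofReal t⁻¹ * volume (imScale t ht ⁻¹' s) := by
    intro s hs
    have hs' : MeasurableSet (imScale t ht ⁻¹' s) := (continuous_imScale ht).measurable hs
    have himg : UpperHalfPlane.coe '' s =
        imScaleCLM t '' (UpperHalfPlane.coe '' (imScale t ht ⁻¹' s)) := by
      have hcoe (z : ℍ) : imScaleCLM t z = imScale t ht z := by
        rw [imScaleCLM_apply]
        apply Complex.ext <;> simp [imScale]
        ring
      ext w
      constructor
      · rintro ⟨z, hz, rfl⟩
        refine ⟨_, ⟨imScale t⁻¹ (inv_pos.mpr ht) z, ?_, rfl⟩, ?_⟩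
        · simpa [imScale_imScale_inv] using hz
        · rw [hcoe, imScale_imScale_inv]
      · rintro ⟨_, ⟨z, hz, rfl⟩, rfl⟩
        exact ⟨_, hz, (hcoe z).symm⟩
    have hinj : Function.Injective (imScaleCLM t) := by
      intro z w h
      rw [imScaleCLM_apply, imScaleCLM_apply] at h
      have h1 := congrArg Complex.re h
      have h2 := congrArg Complex.im h
      simp [ht.ne'] at h1 h2
      exact Complex.ext h1 h2
    rw [volume_eq_lintegral, volume_eq_lintegral, himg,
      lintegral_image_eq_lintegral_abs_det_fderiv_mul volume
        (measurableEmbedding_coe.measurableSet_image.mpr hs')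
        (fun z _ => (imScaleCLM t).hasFDerivAt.hasFDerivWithinAt) hinj.injOn,
      ← lintegral_const_mul' _ _ ENNReal.ofReal_ne_top]
    refine setLIntegral_congr_fun (measurableEmbedding_coe.measurableSet_image.mpr hs') ?_
    rintro _ ⟨z, -, rfl⟩
    have e : (imScaleCLM t z).im = t * (z : ℂ).im := by
      rw [imScaleCLM_apply]; simp; ring
    dsimp only
    rw [det_imScaleCLM, e, abs_of_pos ht, ENNReal.ofReal, ENNReal.ofReal]
    norm_cast
    ext
    have hy : (z : ℂ).im ≠ 0 := z.im_ne_zero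
    simp [ht.le, abs_of_pos ht]
    field_simp
    exact (sq_abs _).symm
  have hmap : (volume : Measure ℍ).map (imScaleEquiv t ht) = ENNReal.ofReal t • volume := by
    ext s hs
    rw [MeasurableEquiv.map_apply, Measure.smul_apply, key s hs, smul_eq_mul, ← mul_assoc,
      ← ENNReal.ofReal_mul ht.le, mul_inv_cancel₀ ht.ne', ENNReal.ofReal_one, one_mul]
    rfl
  have := congrArg (fun μ => μ s) hmap
  rw [MeasurableEquiv.map_apply] at this
  exact this

end Dilation

/-! ### Infinitely many values of c / (cz + d) -/

section Ratio

open MeasureTheory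
open scoped Pointwise

variable {Γ : Subgroup PSL(2, ℝ)}

/-- The quantity `c / (c z + d)`. -/
def ratio (g : SL(2, ℝ)) (z : ℍ) : ℂ := (g 1 0 : ℂ) / cocycle g z

lemma ratio_eq_iff (g h : SL(2, ℝ)) (z : ℍ) :
    ratio g z = ratio h z ↔ g 1 0 * h 1 1 = h 1 0 * g 1 1 := by
  rw [ratio, ratio, div_eq_div_iff (cocycle_ne_zero _ _) (cocycle_ne_zero _ _)]
  simp only [cocycle]
  constructor
  · intro e
    have : (g 1 0 : ℂ) * h 1 1 = h 1 0 * g 1 1 := by linear_combination e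
    exact_mod_cast this
  · intro e
    have : (g 1 0 : ℂ) * h 1 1 = h 1 0 * g 1 1 := by exact_mod_cast e
    linear_combination this

lemma mul_inv_one_zero (g h : SL(2, ℝ)) :
    (g * h⁻¹) 1 0 = g 1 0 * h 1 1 - h 1 0 * g 1 1 := by
  rw [Matrix.SpecialLinearGroup.coe_mul, Matrix.SpecialLinearGroup.coe_inv, Matrix.adjugate_fin_two,
    Matrix.mul_apply, Fin.sum_univ_two]
  simp
  ring

/-- For a group of finite covolume, `c / (c z + d)` takes infinitely many values. -/
theorem infinite_ratio [Countable Γ] (hcov : FiniteCovolume Γ) (z : ℍ) :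
    {q : ℂ | ∃ g : SL(2, ℝ), (g : PSL(2, ℝ)) ∈ Γ ∧ ratio g z = q}.Infinite := by
  intro hfin
  obtain ⟨F, hF, hFfin⟩ := hcov
  choose s hs using fun γ : Γ => exists_sl2_smul_eq (γ : PSL(2, ℝ))
  have hsmul (γ : Γ) (x : ℍ) : γ • x = s γ • x := by
    change (γ : PSL(2, ℝ)) • x = _
    rw [← hs]
    rfl
  have hfin' : (Set.range fun γ : Γ => ratio (s γ) z).Finite :=
    hfin.subset (by rintro _ ⟨γ, rfl⟩; exact ⟨s γ, hs γ ▸ γ.2, rfl⟩)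
  choose! c hc using fun (q : ℂ) (hq : q ∈ Set.range fun γ : Γ => ratio (s γ) z) => hq
  -- the finitely many coset representatives
  set T : Set Γ := c '' Set.range fun γ : Γ => ratio (s γ) z with hT
  have hTfin : T.Finite := hfin'.image c
  set F' : Set ℍ := ⋃ τ ∈ T, (fun x => τ⁻¹ • x) ⁻¹' F with hF'
  have hpre (γ : Γ) : NullMeasurableSet ((fun x : ℍ => γ • x) ⁻¹' F) volume :=
    hF.nullMeasurableSet.preimage (measurePreserving_smul γ volume).quasiMeasurePreserving
  have hF'meas : NullMeasurableSet F' volume :=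
    NullMeasurableSet.biUnion hTfin.countable fun τ _ => hpre τ⁻¹
  have hF'fin : volume F' < ⊤ := by
    refine measure_biUnion_lt_top hTfin fun τ _ => ?_
    rwa [measure_preimage_smul]
  set P : Set Γ := {γ | ∃ g : SL(2, ℝ), (g : PSL(2, ℝ)) = γ ∧ g 1 0 = 0} with hP
  -- Equal ratios mean that γτ⁻¹ is upper triangular, so finitely many ratios leave finitely many
  -- cosets of `P`. Then the `P`-translates of `F'`, a finite union of translates of `F`, cover
  -- almost everything.
  have hfactor (γ : Γ) : ∃ p ∈ P, ∃ τ ∈ T, γ = p * τ := by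
    set τ := c (ratio (s γ) z) with hτ
    have hτ' : ratio (s τ) z = ratio (s γ) z := hc _ ⟨γ, rfl⟩
    refine ⟨γ * τ⁻¹, ⟨s γ * (s τ)⁻¹, ?_, ?_⟩, τ, ⟨_, ⟨γ, rfl⟩, rfl⟩, by group⟩
    · rw [QuotientGroup.mk_mul, QuotientGroup.mk_inv, hs, hs]
      rfl
    · rw [mul_inv_one_zero, sub_eq_zero]
      exact ((ratio_eq_iff _ _ _).mp hτ').symm
  have hcover : ∀ᵐ x : ℍ, ∃ p : P, (p : Γ)⁻¹ • x ∈ F' := by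
    filter_upwards [hF.ae_covers] with x ⟨γ, hγ⟩
    obtain ⟨p, hp, τ, hτ, e⟩ := hfactor γ⁻¹
    refine ⟨⟨p, hp⟩, Set.mem_biUnion hτ ?_⟩
    have : γ = τ⁻¹ * p⁻¹ := by rw [← mul_inv_rev, ← e, inv_inv]
    rw [this, mul_smul] at hγ
    exact hγ
  -- The preimage `A` of `F` under the dilation has area t vol(F). Its `P`-translates are still
  -- almost disjoint, because the dilation commutes with `P`; so `A` can be cut up and moved into
  -- `F'`. Large t is then impossible.
  have hbound (t : ℝ) (ht : 0 < t) : ENNReal.ofReal t * volume F ≤ volume F' := by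
    have hqmp : Measure.QuasiMeasurePreserving (imScale t ht) volume volume := by
      refine ⟨(continuous_imScale ht).measurable, Measure.AbsolutelyContinuous.mk fun u hu h0 => ?_⟩
      rw [Measure.map_apply (continuous_imScale ht).measurable hu, volume_preimage_imScale, h0,
        mul_zero]
    have hcomm (p : P) (x : ℍ) : imScale t ht ((p : Γ) • x) = (p : Γ) • imScale t ht x := by
      obtain ⟨γ, g, hg, hg0⟩ := p
      have e (y : ℍ) : γ • y = g • y := by
        change (γ : PSL(2, ℝ)) • y = _
        rw [← hg]
        rfl
      change imScale t ht (γ • x) = γ • imScale t ht x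
      rw [e, e, imScale_smul ht hg0]
    set A : Set ℍ := imScale t ht ⁻¹' F with hA
    set B : P → Set ℍ := fun p => imScale t ht ⁻¹' ((fun x => (p : Γ) • x) ⁻¹' F) ∩ F' with hB
    have hBmeas (p : P) : NullMeasurableSet (B p) volume :=
      ((hpre p).preimage hqmp).inter hF'meas
    have hBdisj : Pairwise (Function.onFun (AEDisjoint volume) B) := by
      intro p q hpq
      have h1 : AEDisjoint volume ((p : Γ)⁻¹ • F) ((q : Γ)⁻¹ • F) :=
        hF.aedisjoint fun h => hpq (Subtype.ext (inv_injective h))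
      rw [← Set.preimage_smul, ← Set.preimage_smul] at h1
      have h2 : volume (imScale t ht ⁻¹' ((fun x => (p : Γ) • x) ⁻¹' F ∩
          (fun x => (q : Γ) • x) ⁻¹' F)) = 0 := by
        rw [volume_preimage_imScale]
        have h1' : volume ((fun x : ℍ => (p : Γ) • x) ⁻¹' F ∩ (fun x => (q : Γ) • x) ⁻¹' F) = 0 :=
          h1
        rw [h1', mul_zero]
      refine measure_mono_null ?_ h2
      rintro x ⟨hx, hx'⟩
      exact ⟨hx.1, hx'.1⟩
    calc ENNReal.ofReal t * volume F = volume A := (volume_preimage_imScale ht F).symm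
      _ ≤ volume (⋃ p : P, A ∩ (fun x => (p : Γ)⁻¹ • x) ⁻¹' F') := by
        refine measure_mono_ae ?_
        filter_upwards [hcover] with x ⟨p, hp⟩ hxA
        exact Set.mem_iUnion.mpr ⟨p, hxA, hp⟩
      _ ≤ ∑' p : P, volume (A ∩ (fun x => (p : Γ)⁻¹ • x) ⁻¹' F') := measure_iUnion_le _
      _ = ∑' p : P, volume (B p) := by
        refine tsum_congr fun p => ?_
        rw [← measure_preimage_smul (volume : Measure ℍ) (p : Γ)]
        congr 1
        ext x
        simp only [Set.mem_preimage, Set.mem_inter_iff, inv_smul_smul, hA, hB, hcomm]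
      _ ≤ volume (⋃ p, B p) := tsum_meas_le_meas_iUnion_of_disjoint₀ volume hBmeas hBdisj
      _ ≤ volume F' := measure_mono (Set.iUnion_subset fun p => Set.inter_subset_right)
  have hF0 : volume F ≠ 0 := hF.measure_ne_zero (NeZero.ne _)
  have ha : 0 < (volume F).toReal := ENNReal.toReal_pos hF0 hFfin.ne
  have hb := ENNReal.toReal_mono hF'fin.ne (hbound (((volume F').toReal + 1) / (volume F).toReal)
    (by positivity))
  rw [ENNReal.toReal_mul, ENNReal.toReal_ofReal (by positivity), div_mul_cancel₀ _ ha.ne'] at hb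
  linarith

end Ratio

/-! ### The algebra of holomorphic functions of moderate growth -/

section ModerateGrowth

lemma ModerateGrowth.const (c : ℂ) : ModerateGrowth fun _ => c :=
  ⟨‖c‖, 0, fun z => by simp⟩

lemma ModerateGrowth.mul {f g : ℍ → ℂ} (hf : ModerateGrowth f) (hg : ModerateGrowth g) :
    ModerateGrowth (f * g) := by
  obtain ⟨C, N, hf⟩ := hf
  obtain ⟨C', N', hg⟩ := hg
  refine ⟨C * C', N + N', fun z => ?_⟩
  rw [Pi.mul_apply, norm_mul, pow_add, mul_mul_mul_comm]
  exact mul_le_mul (hf z) (hg z) (norm_nonneg _) ((norm_nonneg _).trans (hf z))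

/-- The algebra of holomorphic functions of moderate growth on the upper half-plane. -/
def modHol : Subalgebra ℂ (ℍ → ℂ) where
  carrier := {f | MDiff f ∧ ModerateGrowth f}
  mul_mem' hf hg := ⟨hf.1.mul hg.1, hf.2.mul hg.2⟩
  add_mem' hf hg := ⟨hf.1.add hg.1, hf.2.add hg.2⟩
  algebraMap_mem' c := ⟨mdifferentiable_const, ModerateGrowth.const c⟩

lemma const_mem_modHol (c : ℂ) : (fun _ => c) ∈ modHol := modHol.algebraMap_mem c

lemma coe_mem_modHol : (fun z : ℍ => (z : ℂ)) ∈ modHol := by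
  refine ⟨mdifferentiable_coe, 1, 2, fun z => ?_⟩
  have hy := z.im_pos
  have h1 : z.im ≤ ‖(z : ℂ)‖ := (le_abs_self _).trans (Complex.abs_im_le_norm (z : ℂ))
  rw [one_mul, div_pow, le_div_iff₀ (by positivity)]
  set r := ‖(z : ℂ)‖
  have h2 : z.im ^ 2 ≤ r ^ 2 := by gcongr
  nlinarith [mul_le_mul_of_nonneg_left h2 (norm_nonneg (z : ℂ)), sq_nonneg (r - 1), sq_nonneg (r ^ 2 - r),
    norm_nonneg (z : ℂ)]

lemma cocycle_mem_modHol (g : SL(2, ℝ)) : cocycle g ∈ modHol :=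
  modHol.add_mem (modHol.mul_mem (const_mem_modHol _) coe_mem_modHol) (const_mem_modHol _)

lemma cocycle_inv_mem_modHol (g : SL(2, ℝ)) : (fun z => (cocycle g z)⁻¹) ∈ modHol := by
  refine ⟨mdifferentiable_inv_denom (g : GL (Fin 2) ℝ), ?_⟩
  by_cases hc : g 1 0 = 0
  · refine ⟨‖(g 1 1 : ℂ)⁻¹‖, 0, fun z => ?_⟩
    simp [cocycle, hc]
  · refine ⟨|g 1 0|⁻¹, 1, fun z => ?_⟩
    have hc' : 0 < |g 1 0| := abs_pos.mpr hc
    have h1 : |g 1 0| * z.im ≤ ‖cocycle g z‖ := by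
      refine le_trans (le_of_eq ?_) (Complex.abs_im_le_norm _)
      rw [← abs_of_pos z.im_pos, ← abs_mul]
      simp [cocycle]
    rw [norm_inv, pow_one]
    calc ‖cocycle g z‖⁻¹ ≤ (|g 1 0| * z.im)⁻¹ :=
          inv_anti₀ (mul_pos hc' z.im_pos) h1
      _ = |g 1 0|⁻¹ * z.im⁻¹ := mul_inv _ _
      _ ≤ _ := by gcongr; exact inv_im_le_growth z

lemma cocycle_zpow_mem_modHol (g : SL(2, ℝ)) (k : ℤ) : (fun z => cocycle g z ^ k) ∈ modHol := by
  obtain ⟨n, rfl | rfl⟩ := k.eq_nat_or_neg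
  · simp only [zpow_natCast]
    exact modHol.pow_mem (cocycle_mem_modHol g) n
  · simp only [zpow_neg, zpow_natCast, ← inv_pow]
    exact modHol.pow_mem (cocycle_inv_mem_modHol g) n

lemma ratio_mem_modHol (g : SL(2, ℝ)) : ratio g ∈ modHol :=
  modHol.mul_mem (const_mem_modHol _) (cocycle_inv_mem_modHol g)

/-- Since d(gz, I) ≤ d(z, I) + d(gI, I), translation by `g` multiplies 2 cosh d(z, I) by at most a
constant. -/
lemma comp_smul_mem_modHol {f : ℍ → ℂ} (hf : f ∈ modHol) (g : SL(2, ℝ)) :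
    (fun z => f (g • z)) ∈ modHol := by
  refine ⟨mdifferentiable_comp_smul hf.1 g, ?_⟩
  obtain ⟨C, N, hC⟩ := hf.2
  set K := Real.exp (dist (g • I) I)
  refine ⟨|C| * (2 * K) ^ N, N, fun z => (hC _).trans ?_⟩
  rw [mul_assoc, ← mul_pow]
  refine mul_le_mul (le_abs_self C) ?_ ?_ (abs_nonneg C)
  · have := (g • z).im_pos
    refine pow_le_pow_left₀ (by positivity) ?_ N
    rw [growth_eq_cosh, growth_eq_cosh, Real.cosh_eq, Real.cosh_eq]
    have h1 : dist (g • z) I ≤ dist z I + dist (g • I) I := by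
      rw [← dist_smul g z I]; exact dist_triangle _ _ _
    have h2 : Real.exp (dist (g • z) I) ≤ Real.exp (dist z I) * K := by
      rw [← Real.exp_add]; exact Real.exp_le_exp.mpr h1
    have h3 : Real.exp (-dist (g • z) I) ≤ Real.exp (dist (g • z) I) :=
      Real.exp_le_exp.mpr (by linarith [dist_nonneg (x := g • z) (y := I)])
    have h4 : 0 ≤ K * Real.exp (-dist z I) := by positivity
    nlinarith
  · have := (g • z).im_pos
    positivity

lemma hasDerivAt_D (f : Hol) (z : ℍ) :
    HasDerivAt ((f : ℍ → ℂ) ∘ ofComplex) ((D f : ℍ → ℂ) z) (z : ℂ) :=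
  (UpperHalfPlane.mdifferentiableAt_iff.mp (f.2 z)).hasDerivAt

/-- Cauchy's estimate on the circle of radius y/2. There |w| ≤ 3|z|/2 and Im w ≥ y/2, so the gauge
grows by a factor of at most 5; dividing by the radius costs 2/y, hence one more power. -/
lemma ModerateGrowth.deriv {f : Hol} (hf : ModerateGrowth f) : ModerateGrowth (D f) := by
  obtain ⟨C, N, hC⟩ := hf
  refine ⟨|C| * 5 ^ N * 2, N + 1, fun z => ?_⟩
  have hy := z.im_pos
  have hF := UpperHalfPlane.mdifferentiable_iff.mp f.2
  have him (w : ℂ) (hw : w ∈ Metric.closedBall (z : ℂ) (z.im / 2)) : z.im / 2 ≤ w.im := by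
    have h1 : |(w - z).im| ≤ z.im / 2 :=
      (Complex.abs_im_le_norm _).trans (by simpa [dist_eq_norm] using hw)
    have h2 := (abs_le.mp h1).1
    simp only [Complex.sub_im, coe_im] at h2
    linarith
  have hE1 := one_le_growth z
  set E := (1 + ‖(z : ℂ)‖ ^ 2) / z.im with hE
  have hd : DiffContOnCl ℂ ((f : ℍ → ℂ) ∘ ofComplex) (Metric.ball (z : ℂ) (z.im / 2)) := by
    refine DifferentiableOn.diffContOnCl ?_
    refine hF.mono fun w hw => ?_
    have := him w (Metric.closure_ball_subset_closedBall hw)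
    have h : 0 < w.im := by linarith
    exact h
  have hb : ∀ w ∈ Metric.sphere (z : ℂ) (z.im / 2),
      ‖((f : ℍ → ℂ) ∘ ofComplex) w‖ ≤ |C| * (5 * E) ^ N := by
    intro w hw
    have hwim := him w (Metric.sphere_subset_closedBall hw)
    have hw0 : 0 < w.im := by linarith
    simp only [Function.comp_apply, ofComplex_apply_of_im_pos hw0]
    refine (hC _).trans ?_
    have h1 : z.im ≤ ‖(z : ℂ)‖ := (le_abs_self _).trans (Complex.abs_im_le_norm (z : ℂ))
    have h2 : ‖w‖ ≤ 3 / 2 * ‖(z : ℂ)‖ := by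
      have h3 : ‖w - z‖ = z.im / 2 := by simpa [dist_eq_norm] using hw
      have h4 : ‖w‖ ≤ ‖(z : ℂ)‖ + ‖w - z‖ := by
        simpa using norm_add_le (z : ℂ) (w - z)
      linarith
    have h5 : (1 + ‖w‖ ^ 2) / w.im ≤ 5 * E := by
      rw [hE, div_le_iff₀ hw0, ← mul_div_assoc, div_mul_eq_mul_div, le_div_iff₀ hy]
      have h6 : ‖w‖ ^ 2 ≤ (3 / 2 * ‖(z : ℂ)‖) ^ 2 := by gcongr
      have h7 : (1 + ‖w‖ ^ 2) * z.im ≤ (1 + (3 / 2 * ‖(z : ℂ)‖) ^ 2) * z.im := by gcongr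
      have h8 : 5 * (1 + ‖(z : ℂ)‖ ^ 2) * (z.im / 2) ≤ 5 * (1 + ‖(z : ℂ)‖ ^ 2) * w.im := by gcongr
      nlinarith [mul_nonneg (sq_nonneg ‖(z : ℂ)‖) hy.le]
    change C * ((1 + ‖w‖ ^ 2) / w.im) ^ N ≤ _
    exact mul_le_mul (le_abs_self C) (pow_le_pow_left₀ (by positivity) h5 N) (by positivity)
      (abs_nonneg C)
  have h := Complex.norm_deriv_le_of_forall_mem_sphere_norm_le (half_pos hy) hd hb
  refine h.trans ?_
  have h9 := inv_im_le_growth z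
  rw [← hE] at h9
  calc |C| * (5 * E) ^ N / (z.im / 2) = |C| * 5 ^ N * 2 * E ^ N * z.im⁻¹ := by
        rw [mul_pow]; field_simp
    _ ≤ |C| * 5 ^ N * 2 * E ^ N * E := by gcongr
    _ = _ := by ring

end ModerateGrowth

/-! ### Expansions in c / (cz + d) and their coefficients -/

section Expansion

open Polynomial

variable {Γ : Subgroup PSL(2, ℝ)}

/-- `f` has an expansion of depth less than `n`, with coefficients those of the polynomials `P`. -/
def HasExpansion (Γ : Subgroup PSL(2, ℝ)) (k : ℤ) (n : ℕ) (f : ℍ → ℂ) (P : ℍ → ℂ[X]) : Prop :=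
  (∀ z : ℍ, (P z).degree < n) ∧
    ∀ g : SL(2, ℝ), (g : PSL(2, ℝ)) ∈ Γ → ∀ z : ℍ,
      cocycle g z ^ (-k) * f (g • z) = (P z).eval (ratio g z)

/-- The quantities `c / (c z + d)` take infinitely many values on `Γ`. -/
def InfiniteRatios (Γ : Subgroup PSL(2, ℝ)) : Prop :=
  ∀ z : ℍ, {q : ℂ | ∃ g : SL(2, ℝ), (g : PSL(2, ℝ)) ∈ Γ ∧ ratio g z = q}.Infinite

lemma InfiniteRatios.polynomial_ext (hΓ : InfiniteRatios Γ) {p q : ℂ[X]} {z : ℍ}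
    (h : ∀ g : SL(2, ℝ), (g : PSL(2, ℝ)) ∈ Γ → p.eval (ratio g z) = q.eval (ratio g z)) :
    p = q := by
  refine Polynomial.eq_of_infinite_eval_eq p q ((hΓ z).mono ?_)
  rintro _ ⟨g, hg, rfl⟩
  exact h g hg

lemma HasExpansion.unique (hΓ : InfiniteRatios Γ) {k : ℤ} {n n' : ℕ} {f : ℍ → ℂ}
    {P Q : ℍ → ℂ[X]} (hP : HasExpansion Γ k n f P) (hQ : HasExpansion Γ k n' f Q) (z : ℍ) :
    P z = Q z :=
  hΓ.polynomial_ext fun g hg => by rw [← hP.2 g hg z, ← hQ.2 g hg z]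

lemma HasExpansion.add {k : ℤ} {n : ℕ} {f g : ℍ → ℂ} {P Q : ℍ → ℂ[X]}
    (hP : HasExpansion Γ k n f P) (hQ : HasExpansion Γ k n g Q) :
    HasExpansion Γ k n (f + g) (P + Q) := by
  refine ⟨fun z => (degree_add_le _ _).trans_lt (max_lt (hP.1 z) (hQ.1 z)), fun γ hγ z => ?_⟩
  simp only [Pi.add_apply, eval_add, ← hP.2 γ hγ z, ← hQ.2 γ hγ z]
  ring

lemma HasExpansion.smul {k : ℤ} {n : ℕ} {f : ℍ → ℂ} {P : ℍ → ℂ[X]}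
    (hP : HasExpansion Γ k n f P) (c : ℂ) : HasExpansion Γ k n (c • f) (c • P) := by
  refine ⟨fun z => (degree_smul_le _ _).trans_lt (hP.1 z), fun γ hγ z => ?_⟩
  simp only [Pi.smul_apply, eval_smul, ← hP.2 γ hγ z, smul_eq_mul]
  ring

lemma HasExpansion.mono {k : ℤ} {n m : ℕ} (hnm : n ≤ m) {f : ℍ → ℂ} {P : ℍ → ℂ[X]}
    (hP : HasExpansion Γ k n f P) : HasExpansion Γ k m f P :=
  ⟨fun z => (hP.1 z).trans_le (by exact_mod_cast hnm), hP.2⟩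

lemma HasExpansion.of_coeff_eq_zero {k : ℤ} {n : ℕ} {f : ℍ → ℂ} {P : ℍ → ℂ[X]}
    (hP : HasExpansion Γ k (n + 1) f P) (h : ∀ z, (P z).coeff n = 0) :
    HasExpansion Γ k n f P := by
  refine ⟨fun z => ?_, hP.2⟩
  rw [degree_lt_iff_coeff_zero]
  intro m hm
  rcases hm.eq_or_lt with rfl | hm
  · exact h z
  · exact coeff_eq_zero_of_degree_lt ((hP.1 z).trans_le (by exact_mod_cast hm))

lemma HasExpansion.coeff_zero {k : ℤ} {n : ℕ} {f : ℍ → ℂ} {P : ℍ → ℂ[X]}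
    (hP : HasExpansion Γ k n f P) (z : ℍ) : (P z).coeff 0 = f z := by
  have h := hP.2 1 (by simpa using Γ.one_mem) z
  have h1 : cocycle 1 z = 1 := by simp [cocycle]
  have h2 : ratio 1 z = 0 := by simp [ratio]
  rw [h1, h2, one_zpow, one_mul, one_smul] at h
  rw [coeff_zero_eq_eval_zero, h]

lemma HasExpansion.eq_zero {k : ℤ} {f : ℍ → ℂ} {P : ℍ → ℂ[X]}
    (hP : HasExpansion Γ k 0 f P) : f = 0 := by
  ext z
  have h : P z = 0 := by
    have := hP.1 z
    rwa [Nat.cast_zero, Nat.WithBot.lt_zero_iff, degree_eq_bot] at this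
  rw [← hP.coeff_zero, h]
  simp

lemma hasExpansion_of_mem_modularForms {k : ℤ} {f : Hol} (hf : f ∈ modularForms Γ k) :
    HasExpansion Γ k 1 f fun z => C ((f : ℍ → ℂ) z) :=
  ⟨fun z => by simpa using degree_C_lt, fun g hg z => by simpa using hf.2 g hg z⟩

/-- `HasExpansion` bounds the degree strictly, hence the shift p + 1; its case n = 0 then means f =
0, which starts the induction on depth. -/
lemma mem_quasimodularForms_iff {k : ℤ} {f : Hol} : f ∈ quasimodularForms Γ k ↔
    ModerateGrowth f ∧ ∃ (n : ℕ) (P : ℍ → ℂ[X]), HasExpansion Γ k n f P := by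
  constructor
  · rintro ⟨hf, p, P, hP⟩
    exact ⟨hf, p + 1, P, fun z => degree_lt_iff_coeff_zero _ _ |>.mpr fun m hm =>
      coeff_eq_zero_of_natDegree_lt ((hP.1 z).trans_lt hm), hP.2⟩
  · rintro ⟨hf, n, P, hP⟩
    exact ⟨hf, n, P, fun z => natDegree_le_of_degree_le (hP.1 z).le, hP.2⟩

lemma coeff_prod_mem_modHol {ι : Type*} (s : Finset ι) (P : ι → ℍ → ℂ[X])
    (h : ∀ i ∈ s, ∀ j, (fun z => (P i z).coeff j) ∈ modHol) (j : ℕ) :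
    (fun z => (∏ i ∈ s, P i z).coeff j) ∈ modHol := by
  classical
  induction s using Finset.induction_on generalizing j with
  | empty => simpa only [Finset.prod_empty] using const_mem_modHol _
  | insert a s ha ih =>
    simp only [Finset.prod_insert ha, coeff_mul]
    have e : (fun z => ∑ x ∈ Finset.HasAntidiagonal.antidiagonal j, (P a z).coeff x.1 *
        (∏ i ∈ s, P i z).coeff x.2) = ∑ x ∈ Finset.HasAntidiagonal.antidiagonal j,
        (fun z => (P a z).coeff x.1) * (fun z => (∏ i ∈ s, P i z).coeff x.2) := by
      ext z; simp [Finset.sum_apply]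
    rw [e]
    exact modHol.sum_mem fun x _ => modHol.mul_mem (h a (Finset.mem_insert_self a s) _)
      (ih (fun i hi => h i (Finset.mem_insert_of_mem hi)) _)

/-- The coefficients of an expansion are holomorphic and of moderate growth. -/
lemma HasExpansion.coeff_mem_modHol (hΓ : InfiniteRatios Γ) {k : ℤ} {n : ℕ} {f : ℍ → ℂ}
    (hf : f ∈ modHol) {P : ℍ → ℂ[X]} (hP : HasExpansion Γ k n f P) (j : ℕ) :
    (fun z => (P z).coeff j) ∈ modHol := by
  have hex (i : ℕ) := ((hΓ I).natEmbedding _ i).2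
  choose g hgΓ hg using hex
  have hinj : Function.Injective fun i => ratio (g i) I := by
    intro i i' h
    simp only [hg] at h
    exact (Set.Infinite.natEmbedding _ (hΓ I)).injective (Subtype.ext h)
  -- Whether two ratios coincide does not depend on `z`. The same group elements therefore give
  -- interpolation nodes at every point, and Lagrange's formula expresses the coefficients through
  -- translates of `f`.
  have hinj' (z : ℍ) : Function.Injective fun i => ratio (g i) z := by
    intro i i' h
    exact hinj ((ratio_eq_iff _ _ _).mpr ((ratio_eq_iff _ _ _).mp h))
  have hP' (z : ℍ) : P z = ∑ i ∈ Finset.range n, C (cocycle (g i) z ^ (-k) * f (g i • z)) *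
      Lagrange.basis (Finset.range n) (fun i => ratio (g i) z) i := by
    rw [← Lagrange.interpolate_apply]
    refine Lagrange.eq_interpolate_of_eval_eq _ (hinj' z).injOn ?_ fun i _ => ?_
    · simpa using hP.1 z
    · rw [hP.2 _ (hgΓ i)]
  have e : (fun z => (P z).coeff j) = ∑ i ∈ Finset.range n,
      ((fun z => cocycle (g i) z ^ (-k)) * (fun z => f (g i • z))) *
      (fun z => (Lagrange.basis (Finset.range n) (fun i => ratio (g i) z) i).coeff j) := by
    ext z
    rw [hP', finsetSum_coeff, Finset.sum_apply]
    simp only [coeff_C_mul, Pi.mul_apply]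
  rw [e]
  refine modHol.sum_mem fun i _ => modHol.mul_mem (modHol.mul_mem (cocycle_zpow_mem_modHol _ _)
    (comp_smul_mem_modHol hf _)) ?_
  unfold Lagrange.basis
  refine coeff_prod_mem_modHol _ (fun l z => Lagrange.basisDivisor (ratio (g i) z) (ratio (g l) z))
    (fun l hl m => ?_) j
  have hne : l ≠ i := Finset.ne_of_mem_erase hl
  simp only [Lagrange.basisDivisor, coeff_C_mul, coeff_sub]
  refine modHol.mul_mem (x := fun z => (ratio (g i) z - ratio (g l) z)⁻¹) ?_
    (modHol.sub_mem (const_mem_modHol _) ?_)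
  · set d : ℂ := (g i 1 0 : ℂ) * g l 1 1 - g l 1 0 * g i 1 1 with hd
    have hd0 : d ≠ 0 := by
      rw [hd, sub_ne_zero]
      intro h
      exact hne (hinj ((ratio_eq_iff _ _ _).mpr (by exact_mod_cast h))).symm
    have : (fun z => (ratio (g i) z - ratio (g l) z)⁻¹) =
        (fun _ => d⁻¹) * (cocycle (g i) * cocycle (g l)) := by
      ext z
      have h1 := cocycle_ne_zero (g i) z
      have h2 := cocycle_ne_zero (g l) z
      simp only [Pi.mul_apply, ratio]
      rw [div_sub_div _ _ h1 h2, inv_div, inv_mul_eq_div]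
      congr 1
      simp only [cocycle, hd]
      ring
    rw [this]
    exact modHol.mul_mem (const_mem_modHol _)
      (modHol.mul_mem (cocycle_mem_modHol _) (cocycle_mem_modHol _))
  · simp only [coeff_C]
    split_ifs
    · exact ratio_mem_modHol _
    · exact const_mem_modHol _

/-- Conceptually the logarithmic derivative of `cocycle_mul`: the ratio is that of the cocycle, and
(cz + d)^(-2) is the derivative of the Möbius map. -/
lemma ratio_mul (g h : SL(2, ℝ)) (z : ℍ) :
    ratio (g * h) z = ratio h z + cocycle h z ^ (-2 : ℤ) * ratio g (h • z) := by
  have h1 := cocycle_ne_zero h z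
  have h2 := cocycle_ne_zero g (h • z)
  have hdet : (h 0 0 : ℂ) * h 1 1 - h 0 1 * h 1 0 = 1 := by exact_mod_cast det_eq h
  have e : cocycle g (h • z) * cocycle h z =
      (g 1 0 : ℂ) * (h 0 0 * z + h 0 1) + g 1 1 * cocycle h z := by
    have : cocycle g (h • z) = (g 1 0 : ℂ) * ((h • z : ℍ) : ℂ) + g 1 1 := rfl
    rw [this, coe_smul_eq]
    field_simp
  simp only [ratio, cocycle_mul]
  have e2 : ((g * h) 1 0 : ℂ) = g 1 0 * h 0 0 + g 1 1 * h 1 0 := by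
    simp [Matrix.SpecialLinearGroup.coe_mul, Matrix.mul_apply, Fin.sum_univ_two]
  have e3 : cocycle h z = (h 1 0 : ℂ) * z + h 1 1 := rfl
  have key : ((g 1 0 : ℂ) * h 0 0 + g 1 1 * h 1 0) * cocycle h z =
      h 1 0 * (cocycle g (h • z) * cocycle h z) + g 1 0 := by
    rw [e, e3]
    linear_combination (g 1 0 : ℂ) * hdet
  rw [e2, div_eq_iff (mul_ne_zero h2 h1), zpow_neg]
  field_simp
  linear_combination key

/-- The transformation behaviour of the coefficients of an expansion. -/
lemma HasExpansion.comp_eq (hΓ : InfiniteRatios Γ) {k : ℤ} {n : ℕ} {f : ℍ → ℂ}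
    {P : ℍ → ℂ[X]} (hP : HasExpansion Γ k n f P) {g : SL(2, ℝ)} (hg : (g : PSL(2, ℝ)) ∈ Γ)
    (z : ℍ) : C (cocycle g z ^ (-k)) * P (g • z) =
      (P z).comp (C (ratio g z) + C (cocycle g z ^ (-2 : ℤ)) * X) := by
  -- Both sides, evaluated at the ratio of `h` at `g • z`, compute the value of `f` at `(h * g) •
  -- z`.
  refine hΓ.polynomial_ext (z := g • z) fun h hh => ?_
  have hm : ((h * g : SL(2, ℝ)) : PSL(2, ℝ)) ∈ Γ := Γ.mul_mem hh hg
  rw [eval_mul, eval_C, ← hP.2 h hh, eval_comp]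
  simp only [eval_add, eval_C, eval_mul, eval_X]
  rw [← ratio_mul, ← hP.2 _ hm, cocycle_mul, mul_zpow, mul_smul]
  ring

lemma coeff_comp_linear (p : ℂ[X]) (a b : ℂ) (n : ℕ) :
    (p.comp (C a + C b * X)).coeff n = (hasseDeriv n p).eval a * b ^ n := by
  have : p.comp (C a + C b * X) = (taylor a p).comp (C b * X) := by
    rw [taylor_apply, comp_assoc]
    simp [add_comm]
  rw [this, comp_C_mul_X_coeff, taylor_coeff]

lemma hasseDeriv_eval_of_degree_lt {p : ℂ[X]} {n : ℕ} (hp : p.degree < (n + 2 : ℕ)) (a : ℂ) :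
    (hasseDeriv n p).eval a = p.coeff n + (n + 1) * p.coeff (n + 1) * a := by
  have : hasseDeriv n p = C (p.coeff n) + C ((n + 1) * p.coeff (n + 1)) * X := by
    ext j
    rw [hasseDeriv_coeff]
    match j with
    | 0 => simp
    | 1 => simp [Nat.choose_succ_self_right, add_comm 1 n]
    | j + 2 =>
      rw [coeff_eq_zero_of_degree_lt (hp.trans_le (by
        exact_mod_cast (by omega : n + 2 ≤ j + 2 + n)))]
      rw [coeff_add, coeff_C_mul, coeff_C, coeff_X, if_neg (by omega), if_neg (by omega)]
      simp
  rw [this]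
  simp

/-- Degree n of `comp_eq`: for degree at most n + 1 only two terms of the Taylor shift survive. If
coefficient n + 1 vanishes, coefficient n is modular; if it is constant, coefficient n is
quasimodular of depth at most 1. -/
lemma HasExpansion.coeff_smul (hΓ : InfiniteRatios Γ) {k : ℤ} {n : ℕ} {f : ℍ → ℂ}
    {P : ℍ → ℂ[X]} (hP : HasExpansion Γ k (n + 2) f P) {g : SL(2, ℝ)}
    (hg : (g : PSL(2, ℝ)) ∈ Γ) (z : ℍ) :
    cocycle g z ^ (-(k - 2 * n)) * (P (g • z)).coeff n =
      (P z).coeff n + (n + 1) * (P z).coeff (n + 1) * ratio g z := by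
  have h := congrArg (fun p => p.coeff n) (hP.comp_eq hΓ hg z)
  simp only [coeff_C_mul, coeff_comp_linear] at h
  rw [hasseDeriv_eval_of_degree_lt (by exact_mod_cast hP.1 z)] at h
  have hj := cocycle_ne_zero g z
  have e : cocycle g z ^ (-(k - 2 * n)) =
      (cocycle g z ^ (-k)) * (cocycle g z ^ (2 * n)) := by
    rw [← zpow_natCast, ← zpow_add₀ hj]
    congr 1
    push_cast
    ring
  have e' : (cocycle g z ^ (-2 : ℤ)) ^ n * cocycle g z ^ (2 * n) = 1 := by
    have : cocycle g z ^ (-2 : ℤ) = (cocycle g z ^ 2)⁻¹ := by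
      rw [zpow_neg]
      norm_cast
    rw [this, inv_pow, pow_mul, inv_mul_cancel₀ (pow_ne_zero _ (pow_ne_zero _ hj))]
  rw [e, mul_right_comm, h, mul_assoc, e', mul_one]

/-- The leading coefficient of an expansion is a modular form. -/
lemma HasExpansion.exists_leadingCoeff (hΓ : InfiniteRatios Γ) {k : ℤ} {n : ℕ} {f : ℍ → ℂ}
    (hf : f ∈ modHol) {P : ℍ → ℂ[X]} (hP : HasExpansion Γ k (n + 1) f P) :
    ∃ h : Hol, h ∈ modularForms Γ (k - 2 * n) ∧ ∀ z, (h : ℍ → ℂ) z = (P z).coeff n := by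
  have hmem := hP.coeff_mem_modHol hΓ hf n
  refine ⟨⟨_, hmem.1⟩, ⟨hmem.2, fun g hg z => ?_⟩, fun z => rfl⟩
  have := (hP.mono (m := n + 2) (by omega)).coeff_smul hΓ hg z
  rw [coeff_eq_zero_of_degree_lt (hP.1 z)] at this
  simpa using this

lemma degree_C_add_C_mul_X_lt (a b : ℂ) : (C a + C b * X).degree < ((2 : ℕ) : WithBot ℕ) := by
  rw [add_comm]
  exact degree_linear_le.trans_lt (by norm_num)

/-- If the leading coefficient of an expansion is constant, then the next one is quasimodular. -/
lemma HasExpansion.exists_subleadingCoeff (hΓ : InfiniteRatios Γ) {k : ℤ} {n : ℕ} {f : ℍ → ℂ}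
    (hf : f ∈ modHol) {P : ℍ → ℂ[X]} (hP : HasExpansion Γ k (n + 2) f P) {c : ℂ}
    (hc : ∀ z, (P z).coeff (n + 1) = c) :
    ∃ h : Hol, ModerateGrowth h ∧ HasExpansion Γ (k - 2 * n) 2 h
      fun z => C ((h : ℍ → ℂ) z) + C ((n + 1) * c) * X := by
  have hmem := hP.coeff_mem_modHol hΓ hf n
  refine ⟨⟨_, hmem.1⟩, hmem.2, fun z => degree_C_add_C_mul_X_lt _ _, fun g hg z => ?_⟩
  · have := hP.coeff_smul hΓ hg z
    rw [hc] at this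
    simpa using this

end Expansion

/-! ### Expansions of derivatives -/

section Derivative

open Polynomial

variable {Γ : Subgroup PSL(2, ℝ)}

lemma eval_eq_sum_range_of_degree_lt {p : ℂ[X]} {n : ℕ} (hp : p.degree < n) (x : ℂ) :
    p.eval x = ∑ i ∈ Finset.range n, p.coeff i * x ^ i := by
  by_cases h0 : p = 0
  · simp [h0]
  · exact eval_eq_sum_range' ((natDegree_lt_iff_degree_lt h0).mpr hp) x

lemma hasDerivAt_cocycle_comp (g : SL(2, ℝ)) (z : ℍ) :
    HasDerivAt (cocycle g ∘ ofComplex) (g 1 0 : ℂ) (z : ℂ) := by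
  have h : HasDerivAt (fun w : ℂ => (g 1 0 : ℂ) * w + g 1 1) (g 1 0 : ℂ) (z : ℂ) := by
    simpa using ((hasDerivAt_id (z : ℂ)).const_mul (g 1 0 : ℂ)).add_const (g 1 1 : ℂ)
  refine h.congr_of_eventuallyEq ?_
  filter_upwards [isOpen_upperHalfPlaneSet.mem_nhds z.im_pos] with w hw
  have hw' : 0 < w.im := hw
  simp [cocycle, ofComplex_apply_of_im_pos hw']

lemma hasDerivAt_ratio_comp (g : SL(2, ℝ)) (z : ℍ) :
    HasDerivAt (ratio g ∘ ofComplex) (-ratio g z ^ 2) (z : ℂ) := by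
  have h0 : (cocycle g ∘ ofComplex) z ≠ 0 := by simpa using cocycle_ne_zero g z
  have h := (hasDerivAt_const (z : ℂ) (g 1 0 : ℂ)).div (hasDerivAt_cocycle_comp g z) h0
  refine h.congr_deriv ?_
  have h1 := cocycle_ne_zero g z
  simp [ratio]
  field_simp

lemma hasDerivAt_comp_smul (f : Hol) (g : SL(2, ℝ)) (z : ℍ) :
    HasDerivAt ((fun z : ℍ => (f : ℍ → ℂ) (g • z)) ∘ ofComplex)
      ((D f : ℍ → ℂ) (g • z) * (cocycle g z ^ 2)⁻¹) (z : ℂ) := by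
  have h1 : HasDerivAt (fun w : ℂ => ((g • ofComplex w : ℍ) : ℂ)) ((cocycle g z ^ 2)⁻¹) (z : ℂ) := by
    have h := (hasStrictDerivAt_smul (g := (g : GL (Fin 2) ℝ)) (by simp) z).hasDerivAt
    refine h.congr_deriv ?_
    rw [show ((g : GL (Fin 2) ℝ) : Matrix (Fin 2) (Fin 2) ℝ).det = 1 by simp]
    rw [Complex.ofReal_one, one_div]
    rfl
  have h2 := hasDerivAt_D f (g • z)
  have h2' : HasDerivAt ((f : ℍ → ℂ) ∘ ofComplex) ((D f : ℍ → ℂ) (g • z))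
      ((fun w : ℂ => ((g • ofComplex w : ℍ) : ℂ)) (z : ℂ)) := by
    simpa using h2
  refine (h2'.comp (z : ℂ) h1).congr_of_eventuallyEq ?_
  filter_upwards with w
  simp

/-- The expansion of the derivative of a quasimodular form. -/
lemma HasExpansion.deriv (hΓ : InfiniteRatios Γ) {k : ℤ} {n : ℕ} {f : Hol}
    (hf : ModerateGrowth f) {P : ℍ → ℂ[X]} (hP : HasExpansion Γ k (n + 1) f P) :
    ∃ Q : ℍ → ℂ[X], HasExpansion Γ (k + 2) (n + 2) (D f) Q ∧
      ∀ z, (Q z).coeff (n + 1) = (k - n) * (P z).coeff n := by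
  have hmem (j : ℕ) := (hP.coeff_mem_modHol hΓ ⟨f.2, hf⟩ j).1
  set u : ℕ → Hol := fun j => ⟨_, hmem j⟩ with hu
  have hu' (j : ℕ) (z : ℍ) : (u j : ℍ → ℂ) z = (P z).coeff j := rfl
  -- Differentiate f(gz) = j^k Σ u_i r^i for the cocycle j and ratio r, using j' = j r and r' = -r²:
  -- each i contributes u_i' r^i + (k - i) u_i r^(i+1).
  set Q : ℍ → ℂ[X] := fun z => ∑ i ∈ Finset.range (n + 1),
    (C ((D (u i) : ℍ → ℂ) z) * X ^ i + C ((k - i) * (u i : ℍ → ℂ) z) * X ^ (i + 1)) with hQ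
  refine ⟨Q, ⟨fun z => ?_, fun g hg z => ?_⟩, fun z => ?_⟩
  · refine (degree_lt_iff_coeff_zero _ _).mpr fun m hm => ?_
    rw [hQ, finsetSum_coeff]
    refine Finset.sum_eq_zero fun i hi => ?_
    have := Finset.mem_range.mp hi
    rw [coeff_add, coeff_C_mul_X_pow, coeff_C_mul_X_pow, if_neg (by omega), if_neg (by omega),
      add_zero]
  · have hj := cocycle_ne_zero g z
    have hpow : HasDerivAt ((fun z => cocycle g z ^ k) ∘ ofComplex)
        (k * cocycle g z ^ (k - 1) * g 1 0) (z : ℂ) := by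
      have h0 : (cocycle g ∘ ofComplex) z ≠ 0 := by simpa using hj
      have := (hasDerivAt_zpow k _ (Or.inl h0)).comp (z : ℂ) (hasDerivAt_cocycle_comp g z)
      refine this.congr_deriv ?_
      simp
    have hsum : HasDerivAt (fun w : ℂ => ∑ i ∈ Finset.range (n + 1),
        ((u i : ℍ → ℂ) ∘ ofComplex) w * (ratio g ∘ ofComplex) w ^ i)
        (∑ i ∈ Finset.range (n + 1), ((D (u i) : ℍ → ℂ) z * ratio g z ^ i -
          i * (u i : ℍ → ℂ) z * ratio g z ^ (i + 1))) (z : ℂ) := by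
      refine HasDerivAt.fun_sum fun i _ => ?_
      refine ((hasDerivAt_D (u i) z).mul ((hasDerivAt_ratio_comp g z).fun_pow i)).congr_deriv ?_
      rcases i with _ | i
      · simp
      · simp
        ring
    have hR := hpow.mul hsum
    have hL := hasDerivAt_comp_smul f g z
    have hEq : ((fun z : ℍ => (f : ℍ → ℂ) (g • z)) ∘ ofComplex) =
        (((fun z => cocycle g z ^ k) ∘ ofComplex) * fun w : ℂ => ∑ i ∈ Finset.range (n + 1),
        ((u i : ℍ → ℂ) ∘ ofComplex) w * (ratio g ∘ ofComplex) w ^ i) := by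
      ext w
      have h1 := hP.2 g hg (ofComplex w)
      rw [eval_eq_sum_range_of_degree_lt (hP.1 _)] at h1
      have h2 := cocycle_ne_zero g (ofComplex w)
      simp only [Function.comp_apply, Pi.mul_apply, hu']
      rw [← h1, zpow_neg, mul_inv_cancel_left₀ (zpow_ne_zero _ h2)]
    rw [hEq] at hL
    have h := hL.unique hR
    simp only [Function.comp_apply, ofComplex_apply] at h
    have hQe : (Q z).eval (ratio g z) = k * ratio g z * (∑ i ∈ Finset.range (n + 1),
        (u i : ℍ → ℂ) z * ratio g z ^ i) + ∑ i ∈ Finset.range (n + 1),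
        ((D (u i) : ℍ → ℂ) z * ratio g z ^ i - i * (u i : ℍ → ℂ) z * ratio g z ^ (i + 1)) := by
      simp only [hQ, eval_finsetSum, eval_add, eval_mul, eval_C, eval_pow, eval_X]
      rw [Finset.mul_sum, ← Finset.sum_add_distrib]
      refine Finset.sum_congr rfl fun i _ => ?_
      ring
    rw [hQe]
    have e1 : cocycle g z ^ (-(k + 2)) * (D f : ℍ → ℂ) (g • z) =
        cocycle g z ^ (-k) * ((D f : ℍ → ℂ) (g • z) * (cocycle g z ^ 2)⁻¹) := by
      rw [neg_add, zpow_add₀ hj]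
      have : cocycle g z ^ (-2 : ℤ) = (cocycle g z ^ 2)⁻¹ := by
        rw [zpow_neg]
        norm_cast
      rw [this]
      ring
    rw [e1, h, mul_add]
    have e2 : cocycle g z ^ (-k) * cocycle g z ^ k = 1 := by
      rw [← zpow_add₀ hj, neg_add_cancel, zpow_zero]
    have e3 : cocycle g z ^ (-k) * (k * cocycle g z ^ (k - 1) * g 1 0) = k * ratio g z := by
      rw [zpow_sub_one₀ hj, ratio]
      linear_combination (k * (cocycle g z)⁻¹ * g 1 0 : ℂ) * e2
    rw [← mul_assoc, e3, ← mul_assoc, e2, one_mul]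
  · rw [hQ, finsetSum_coeff, Finset.sum_range_succ]
    have : ∑ i ∈ Finset.range n, (C ((D (u i) : ℍ → ℂ) z) * X ^ i +
        C ((k - i) * (u i : ℍ → ℂ) z) * X ^ (i + 1) : ℂ[X]).coeff (n + 1) = 0 := by
      refine Finset.sum_eq_zero fun i hi => ?_
      have := Finset.mem_range.mp hi
      rw [coeff_add, coeff_C_mul_X_pow, coeff_C_mul_X_pow, if_neg (by omega), if_neg (by omega),
        add_zero]
    rw [this, coeff_add, coeff_C_mul_X_pow, coeff_C_mul_X_pow, if_neg (by omega), if_pos rfl,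
      zero_add, zero_add]

lemma ModerateGrowth.iterate_deriv {f : Hol} (hf : ModerateGrowth f) (i : ℕ) :
    ModerateGrowth ((D ^ i) f) := by
  induction i with
  | zero => exact hf
  | succ i ih =>
    rw [pow_succ']
    exact ih.deriv

/-- The leading coefficient of the expansion of an iterated derivative. -/
lemma HasExpansion.iterate_deriv (hΓ : InfiniteRatios Γ) {k : ℤ} {n : ℕ} {f : Hol}
    (hf : ModerateGrowth f) {P : ℍ → ℂ[X]} (hP : HasExpansion Γ k (n + 1) f P)
    (hk : (n : ℤ) < k) (i : ℕ) :
    ∃ Q : ℍ → ℂ[X], HasExpansion Γ (k + 2 * i) (n + i + 1) ((D ^ i) f) Q ∧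
      ∃ c : ℂ, c ≠ 0 ∧ ∀ z, (Q z).coeff (n + i) = c * (P z).coeff n := by
  induction i with
  | zero => exact ⟨P, by simpa using hP, 1, one_ne_zero, by simp⟩
  | succ i ih =>
    obtain ⟨Q, hQ, c, hc, hQc⟩ := ih
    obtain ⟨R, hR, hRc⟩ := hQ.deriv hΓ (hf.iterate_deriv i)
    -- The new factor is weight minus depth, (k + 2i) - (n + i), which is positive because n < k.
    refine ⟨R, ?_, (k - n + i) * c, mul_ne_zero ?_ hc, fun z => ?_⟩
    · rw [pow_succ']
      have e : k + 2 * ((i + 1 : ℕ) : ℤ) = k + 2 * i + 2 := by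
        push_cast
        ring
      rw [e]
      exact hR
    · have : (k - n + i : ℤ) ≠ 0 := by omega
      exact_mod_cast this
    · rw [← add_assoc, hRc, hQc]
      push_cast
      ring

end Derivative

/-! ### Weight two and the map `δ` -/

section Delta

open Polynomial

variable {Γ : Subgroup PSL(2, ℝ)}

lemma IsExpansion.hasExpansion {k : ℤ} {p : ℕ} {f : ℍ → ℂ} {P : ℍ → ℂ[X]}
    (hP : IsExpansion Γ k p f P) : HasExpansion Γ k (p + 1) f P :=
  ⟨fun z => (degree_lt_iff_coeff_zero _ _).mpr fun _ hm =>
    coeff_eq_zero_of_natDegree_lt ((hP.1 z).trans_lt hm), hP.2⟩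

/-- The leading coefficient vanishes if its weight is negative. -/
lemma HasExpansion.of_weight_neg [Countable Γ] (hcov : FiniteCovolume Γ) (hΓ : InfiniteRatios Γ)
    {k : ℤ} {n : ℕ} {f : ℍ → ℂ} (hf : f ∈ modHol) {P : ℍ → ℂ[X]}
    (hP : HasExpansion Γ k (n + 1) f P) (hk : k < 2 * n) : HasExpansion Γ k n f P := by
  obtain ⟨h, hh, hhP⟩ := hP.exists_leadingCoeff hΓ hf
  have h0 := eq_zero_of_mem_modularForms_neg hcov (by omega) hh
  refine hP.of_coeff_eq_zero fun z => ?_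
  rw [← hhP, h0]
  rfl

/-- The leading coefficient is constant if its weight is zero. -/
lemma HasExpansion.exists_leadingCoeff_eq_const [Countable Γ] (hcov : FiniteCovolume Γ)
    (hΓ : InfiniteRatios Γ) {k : ℤ} {n : ℕ} {f : ℍ → ℂ} (hf : f ∈ modHol) {P : ℍ → ℂ[X]}
    (hP : HasExpansion Γ k (n + 1) f P) (hk : k = 2 * n) : ∃ c, ∀ z, (P z).coeff n = c := by
  obtain ⟨h, hh, hhP⟩ := hP.exists_leadingCoeff hΓ hf
  obtain ⟨c, hc⟩ := eq_const_of_mem_modularForms_zero (f := h) hcov (by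
    rwa [hk, sub_self] at hh)
  exact ⟨c, fun z => by rw [← hhP, hc]⟩

/-- A top coefficient in degree m + 2 would have weight 2 - 2(m + 2) < 0, so the degrees above 1 are
stripped off one by one. -/
lemma HasExpansion.depth_le_one [Countable Γ] (hcov : FiniteCovolume Γ) (hΓ : InfiniteRatios Γ)
    {n : ℕ} {f : ℍ → ℂ} (hf : f ∈ modHol) {P : ℍ → ℂ[X]} (hP : HasExpansion Γ 2 n f P) :
    HasExpansion Γ 2 2 f P := by
  suffices ∀ m, HasExpansion Γ 2 (m + 2) f P → HasExpansion Γ 2 2 f P from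
    this n (hP.mono (by omega))
  intro m
  induction m with
  | zero => exact id
  | succ m ih => exact fun h => ih (h.of_weight_neg hcov hΓ hf (by push_cast; omega))

/-- In weight 2 the coefficient of degree 1 is a top coefficient of weight 0, hence constant;
uniqueness of expansions makes it independent of choices and linear in `f`. -/
lemma exists_delta [Countable Γ] (hcov : FiniteCovolume Γ) (hΓ : InfiniteRatios Γ) :
    ∃ δ : quasimodularForms Γ 2 →ₗ[ℂ] ℂ, ∀ (f : quasimodularForms Γ 2) (n : ℕ) (P : ℍ → ℂ[X]),
      HasExpansion Γ 2 n (f : Hol) P → ∀ z, (P z).coeff 1 = δ f := by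
  have hex (f : quasimodularForms Γ 2) : ∃ c : ℂ, ∀ (n : ℕ) (P : ℍ → ℂ[X]),
      HasExpansion Γ 2 n (f : Hol) P → ∀ z, (P z).coeff 1 = c := by
    obtain ⟨hf, n, P, hP⟩ := mem_quasimodularForms_iff.mp f.2
    have hf' : ((f : Hol) : ℍ → ℂ) ∈ modHol := ⟨(f : Hol).2, hf⟩
    obtain ⟨c, hc⟩ := (hP.depth_le_one hcov hΓ hf').exists_leadingCoeff_eq_const hcov hΓ hf'
      (by norm_num)
    exact ⟨c, fun n' Q hQ z => by rw [hQ.unique hΓ hP z, hc]⟩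
  have hexp (f : quasimodularForms Γ 2) : ∃ P : ℍ → ℂ[X], HasExpansion Γ 2 2 (f : Hol) P := by
    obtain ⟨hf, n, P, hP⟩ := mem_quasimodularForms_iff.mp f.2
    exact ⟨P, hP.depth_le_one hcov hΓ ⟨(f : Hol).2, hf⟩⟩
  choose δ hδ using hex
  choose P hP using hexp
  refine ⟨⟨⟨δ, fun f g => ?_⟩, fun c f => ?_⟩, hδ⟩
  · rw [← hδ f _ _ (hP f) I, ← hδ g _ _ (hP g) I, ← hδ (f + g) _ _ ((hP f).add (hP g)) I]
    simp
  · change δ (c • f) = c • δ f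
    rw [← hδ f _ _ (hP f) I, ← hδ (c • f) _ _ ((hP f).smul c) I]
    simp

lemma exact_delta [Countable Γ] (hcov : FiniteCovolume Γ) (hΓ : InfiniteRatios Γ)
    {δ : quasimodularForms Γ 2 →ₗ[ℂ] ℂ}
    (hδ : ∀ (f : quasimodularForms Γ 2) (n : ℕ) (P : ℍ → ℂ[X]),
      HasExpansion Γ 2 n (f : Hol) P → ∀ z, (P z).coeff 1 = δ f) :
    Function.Exact (Submodule.inclusion (modularForms_le Γ 2)) δ := by
  intro f
  constructor
  · intro h0
    obtain ⟨hf, n, P, hP⟩ := mem_quasimodularForms_iff.mp f.2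
    have hf' : ((f : Hol) : ℍ → ℂ) ∈ modHol := ⟨(f : Hol).2, hf⟩
    have hP1 : HasExpansion Γ 2 1 (f : Hol) P := (hP.depth_le_one hcov hΓ hf').of_coeff_eq_zero
      fun z => by rw [hδ f _ _ hP, h0]
    refine ⟨⟨f, hf, fun g hg z => ?_⟩, rfl⟩
    rw [hP1.2 g hg z, eval_eq_sum_range_of_degree_lt (hP1.1 z)]
    simp [hP1.coeff_zero]
  · rintro ⟨g, rfl⟩
    rw [← hδ _ _ _ (hasExpansion_of_mem_modularForms g.2) I]
    simp [coeff_C]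

end Delta

/-! ### Direct sum decomposition by depth -/

section Graded

open Polynomial

variable {Γ : Subgroup PSL(2, ℝ)}

lemma gradedD_pow_inWeight (i k : ℕ) (f : Hol) :
    (gradedD ^ i) (inWeight k f) = inWeight (k + 2 * i) ((D ^ i) f) := by
  induction i with
  | zero => rfl
  | succ i ih =>
    rw [pow_succ', Module.End.mul_apply, ih, pow_succ']
    exact DirectSum.toModule_lof (M := fun _ => Hol) ℂ (k + 2 * i) ((D ^ i) f)

lemma inWeight_apply (k j : ℕ) (f : Hol) : inWeight k f j = if k = j then f else 0 := by
  split_ifs with h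
  · subst h
    exact DirectSum.of_eq_same (β := fun _ => Hol) k f
  · exact DirectSum.of_eq_of_ne (β := fun _ => Hol) k j f (Ne.symm h)

/-- `u` has an expansion whose leading coefficient, in degree `l`, is nonzero. -/
def HasExactDepth (Γ : Subgroup PSL(2, ℝ)) (k : ℤ) (l : ℕ) (u : ℍ → ℂ) : Prop :=
  ∃ P : ℍ → ℂ[X], HasExpansion Γ k (l + 1) u P ∧ ∃ z, (P z).coeff l ≠ 0

lemma HasExpansion.sum {ι : Type*} {k : ℤ} {n : ℕ} (s : Finset ι) {u : ι → Hol}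
    {P : ι → ℍ → ℂ[X]} (h : ∀ a ∈ s, HasExpansion Γ k n (u a) (P a)) :
    HasExpansion Γ k n (∑ a ∈ s, u a : Hol) (∑ a ∈ s, P a) := by
  classical
  induction s using Finset.induction_on with
  | empty =>
    exact ⟨fun z => by simp, fun g _ z => by simp⟩
  | insert a s ha ih =>
    rw [Finset.sum_insert ha, Finset.sum_insert ha]
    exact (h a (Finset.mem_insert_self a s)).add
      (ih fun b hb => h b (Finset.mem_insert_of_mem hb))

/-- The nonzero term of largest depth alone contributes in its degree, while by uniqueness the sum
has expansion 0. -/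
lemma HasExactDepth.eq_zero_of_sum_eq_zero (hΓ : InfiniteRatios Γ) {ι : Type*} {k : ℤ}
    {s : Finset ι} {u : ι → Hol} {l : ι → ℕ}
    (hu : ∀ a ∈ s, u a ≠ 0 → HasExactDepth Γ k (l a) (u a))
    (hl : ∀ a ∈ s, ∀ b ∈ s, u a ≠ 0 → u b ≠ 0 → l a = l b → a = b)
    (hsum : ∑ a ∈ s, u a = 0) : ∀ a ∈ s, u a = 0 := by
  classical
  by_contra! hne
  set s' := s.filter fun a => u a ≠ 0 with hs'
  have hs'ne : s'.Nonempty := by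
    obtain ⟨a, ha, h⟩ := hne
    exact ⟨a, Finset.mem_filter.mpr ⟨ha, h⟩⟩
  have hsum' : ∑ a ∈ s', u a = 0 := by rw [hs', Finset.sum_filter_ne_zero, hsum]
  obtain ⟨a, ha, hmax⟩ := s'.exists_max_image l hs'ne
  have hu' : ∀ b ∈ s', HasExactDepth Γ k (l b) (u b) := fun b hb =>
    hu b (Finset.mem_filter.mp hb).1 (Finset.mem_filter.mp hb).2
  choose! P hP using hu'
  obtain ⟨z, hz⟩ := (hP a ha).2
  have h1 : HasExpansion Γ k (l a + 1) (∑ b ∈ s', u b : Hol) (∑ b ∈ s', P b) :=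
    HasExpansion.sum s' fun b hb => (hP b hb).1.mono (by have := hmax b hb; omega)
  rw [hsum'] at h1
  have h2 : HasExpansion Γ k 0 ((0 : Hol) : ℍ → ℂ) 0 :=
    ⟨fun z => by simp, fun g _ z => by simp⟩
  have h3 := congrArg (fun p => p.coeff (l a)) (h1.unique hΓ h2 z)
  simp only [Finset.sum_apply, finsetSum_coeff, Pi.zero_apply, coeff_zero] at h3
  rw [Finset.sum_eq_single_of_mem a ha] at h3
  · exact hz h3
  · intro b hb hba
    have hlt : l b < l a := lt_of_le_of_ne (hmax b hb) fun h =>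
      hba (hl b (Finset.mem_filter.mp hb).1 a (Finset.mem_filter.mp ha).1
        (Finset.mem_filter.mp hb).2 (Finset.mem_filter.mp ha).2 h)
    exact coeff_eq_zero_of_degree_lt (((hP b hb).1.1 z).trans_le (by exact_mod_cast hlt))

/-- Graded subspaces whose components in each weight have pairwise different exact depths are
independent. -/
lemma iSupIndep_of_hasExactDepth (hΓ : InfiniteRatios Γ) {ι : Type} {W : ι → Submodule ℂ GrHol}
    {l : ι → ℕ} {occurs : ι → ℕ → Prop}
    (hW : ∀ a, ∀ w ∈ W a, ∀ k : ℕ, w k ≠ 0 → occurs a k ∧ HasExactDepth Γ k (l a) (w k))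
    (hl : ∀ a b k, occurs a k → occurs b k → l a = l b → a = b) : iSupIndep W := by
  refine (iSupIndep_iff_finsetSum_eq_zero_imp_eq_zero (N := GrHol) W).mpr ?_
  intro s w hw hsum a ha
  refine DFinsupp.ext fun k => ?_
  refine HasExactDepth.eq_zero_of_sum_eq_zero hΓ (k := k) (s := s) (u := fun a => w a k)
    (l := l) (fun a ha h => ((hW a _ (hw a ha) k) h).2) (fun a ha b hb h h' e => ?_) ?_ a ha
  · exact hl a b k (hW a _ (hw a ha) k h).1 (hW b _ (hw b hb) k h').1 e
  · have := congrArg (fun v : GrHol => v k) hsum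
    simp only at this
    rwa [DFinsupp.finsetSum_apply] at this

/-- The component is D^i(g) with g modular of weight k - 2i > 0, and its coefficient of degree i is
a nonzero multiple of g. -/
lemma exactDepth_of_mem_modularSummands (hΓ : InfiniteRatios Γ) (i : ℕ) {w : GrHol}
    (hw : w ∈ modularSummands Γ (.inr i)) (k : ℕ) (hk : w k ≠ 0) :
    2 * i < k ∧ HasExactDepth Γ k i (w k) := by
  set N : Submodule ℂ Hol :=
    if 2 * i < k then (modularForms Γ ((k : ℤ) - 2 * i)).map (D ^ i) else ⊥ with hN
  have hle : modularSummands Γ (.inr i) ≤ N.comap (DirectSum.component ℂ ℕ (fun _ => Hol) k) := by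
    rw [modularSummands, gradedModularFormsPos, Submodule.map_iSup]
    refine iSup_le fun m => ?_
    rintro _ ⟨_, ⟨g, hg, rfl⟩, rfl⟩
    rw [Submodule.mem_comap, gradedD_pow_inWeight]
    change inWeight (m + 1 + 2 * i) ((D ^ i) g) k ∈ N
    rw [inWeight_apply]
    split_ifs with h
    · rw [hN, if_pos (by omega)]
      refine ⟨g, ?_, rfl⟩
      have : (k : ℤ) - 2 * i = ((m + 1 : ℕ) : ℤ) := by omega
      rw [this]
      exact hg
    · exact N.zero_mem
  have hmem : w k ∈ N := hle hw
  by_cases h : 2 * i < k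
  · rw [hN, if_pos h] at hmem
    obtain ⟨g, hg, hgw⟩ := hmem
    obtain ⟨Q, hQ, c, hc, hQc⟩ := (hasExpansion_of_mem_modularForms hg).iterate_deriv hΓ hg.1
      (by push_cast; omega) i
    refine ⟨h, Q, ?_, ?_⟩
    · rw [← hgw]
      simpa using hQ
    · by_contra! hz
      apply hk
      have hg0 : g = 0 := by
        ext z
        have := hQc z
        rw [zero_add, hz z] at this
        simpa [hc] using this.symm
      rw [← hgw, hg0, map_zero]
  · rw [hN, if_neg h] at hmem
    exact absurd hmem hk

lemma exactDepth_of_mem_constants {w : GrHol} (hw : w ∈ modularSummands Γ (.inl ()))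
    (k : ℕ) (hk : w k ≠ 0) : k = 0 ∧ HasExactDepth Γ k 0 (w k) := by
  obtain ⟨c, rfl⟩ := Submodule.mem_span_singleton.mp hw
  rw [← map_smul, inWeight_apply] at hk ⊢
  split_ifs at hk ⊢ with h
  · subst h
    refine ⟨rfl, fun _ => C c, ⟨fun z => by simpa using degree_C_lt, fun g _ z => by simp⟩, I, ?_⟩
    rintro h0
    apply hk
    have : c = 0 := by simpa using h0
    rw [this, zero_smul]
  · exact absurd rfl hk

/-- The depth of the elements of the summands `ℂ` and `D^i(⨁_{k > 0} M_k(Γ))`. -/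
def summandDepth : Unit ⊕ ℕ → ℕ
  | .inl _ => 0
  | .inr i => i

/-- The weights in which the summands `ℂ` and `D^i(⨁_{k > 0} M_k(Γ))` live. -/
def summandOccurs : Unit ⊕ ℕ → ℕ → Prop
  | .inl _, k => k = 0
  | .inr i, k => 2 * i < k

lemma exactDepth_of_mem_summand (hΓ : InfiniteRatios Γ) (a : Unit ⊕ ℕ) (w : GrHol)
    (hw : w ∈ modularSummands Γ a) (k : ℕ) (hk : w k ≠ 0) :
    summandOccurs a k ∧ HasExactDepth Γ k (summandDepth a) (w k) := by
  match a with
  | .inl () => exact exactDepth_of_mem_constants hw k hk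
  | .inr i => exact exactDepth_of_mem_modularSummands hΓ i hw k hk

/-- The constants and the modular forms themselves share depth 0; only the weight, zero or positive,
separates them. -/
lemma summandDepth_inj (a b : Unit ⊕ ℕ) (k : ℕ) (ha : summandOccurs a k)
    (hb : summandOccurs b k) (h : summandDepth a = summandDepth b) : a = b := by
  match a, b with
  | .inl (), .inl () => rfl
  | .inr i, .inr j => exact congrArg _ h
  | .inl (), .inr j => simp only [summandOccurs] at ha hb; omega
  | .inr i, .inl () => simp only [summandOccurs] at ha hb; omega

lemma iSupIndep_modularSummands (hΓ : InfiniteRatios Γ) : iSupIndep (modularSummands Γ) :=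
  iSupIndep_of_hasExactDepth hΓ (exactDepth_of_mem_summand hΓ) summandDepth_inj

lemma hasExactDepth_iterate_deriv (hΓ : InfiniteRatios Γ) {φ : Hol} (hφ : ModerateGrowth φ)
    {P : ℍ → ℂ[X]} (hP : HasExpansion Γ 2 2 φ P) {a : ℂ} (ha : a ≠ 0)
    (hPa : ∀ z, (P z).coeff 1 = a) (i : ℕ) :
    HasExactDepth Γ ((2 + 2 * i : ℕ) : ℤ) (i + 1) ((D ^ i) φ) := by
  obtain ⟨Q, hQ, c, hc, hQc⟩ := hP.iterate_deriv (n := 1) hΓ hφ (by norm_num) i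
  rw [add_comm 1 i] at hQ hQc
  refine ⟨Q, by exact_mod_cast hQ, I, ?_⟩
  rw [hQc, hPa]
  exact mul_ne_zero hc ha

lemma HasExactDepth.ne_zero (hΓ : InfiniteRatios Γ) {k : ℤ} {l : ℕ} {u : ℍ → ℂ}
    (h : HasExactDepth Γ k l u) : u ≠ 0 := by
  rintro rfl
  obtain ⟨P, hP, z, hz⟩ := h
  have h2 : HasExpansion Γ k 0 (0 : ℍ → ℂ) 0 := ⟨fun z => by simp, fun g _ z => by simp⟩
  rw [hP.unique hΓ h2 z] at hz
  simp at hz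

lemma HasExactDepth.smul {k : ℤ} {l : ℕ} {u : ℍ → ℂ} (h : HasExactDepth Γ k l u) {c : ℂ}
    (hc : c ≠ 0) : HasExactDepth Γ k l (c • u) := by
  obtain ⟨P, hP, z, hz⟩ := h
  exact ⟨c • P, hP.smul c, z, by simpa [hc] using hz⟩

lemma iSupIndep_modularSummands_lineSummands (hΓ : InfiniteRatios Γ) {φ : Hol}
    (hφ : ∀ i, HasExactDepth Γ ((2 + 2 * i : ℕ) : ℤ) (i + 1) ((D ^ i) φ)) :
    iSupIndep (Sum.elim (modularSummands Γ) (lineSummands φ)) := by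
  refine iSupIndep_of_hasExactDepth hΓ (l := Sum.elim summandDepth fun i => i + 1)
    (occurs := Sum.elim summandOccurs fun i k => k = 2 + 2 * i) ?_ ?_
  · rintro (a | i) w hw k hk
    · exact exactDepth_of_mem_summand hΓ a w hw k hk
    · obtain ⟨c, rfl⟩ := Submodule.mem_span_singleton.mp hw
      rw [gradedD_pow_inWeight, ← map_smul, inWeight_apply] at hk ⊢
      split_ifs at hk ⊢ with h
      · refine ⟨h.symm, ?_⟩
        subst h
        have hc : c ≠ 0 := by
          rintro rfl
          exact hk (zero_smul _ _)
        exact (hφ i).smul hc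
      · exact absurd rfl hk
  · rintro (a | i) (b | j) k ha hb h
    · exact congrArg _ (summandDepth_inj a b k ha hb h)
    -- D^i(φ) has weight 2i + 2 and depth i + 1, exactly half the weight; D^m of a modular form of
    -- positive weight has depth m below half its weight.
    · match a with
      | .inl () => simp [summandDepth] at h
      | .inr m => simp only [Sum.elim_inl, Sum.elim_inr, summandOccurs, summandDepth] at ha hb h; omega
    · match b with
      | .inl () => simp [summandDepth] at h
      | .inr m => simp only [Sum.elim_inl, Sum.elim_inr, summandOccurs, summandDepth] at ha hb h; omega
    · simp only [Sum.elim_inr] at h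
      rw [Nat.succ_injective h]

/-- By induction on the depth, quasimodular forms are spanned by constants, derivatives of modular
forms of positive weight, and forms whose leading coefficients are those of derivatives of
quasimodular forms of weight `2`. -/
lemma inWeight_mem_of_hasExpansion [Countable Γ] (hcov : FiniteCovolume Γ) (hΓ : InfiniteRatios Γ)
    {S : Submodule ℂ GrHol} (hconst : gradedConstants ≤ S)
    (hmod : ∀ i, modularSummands Γ (.inr i) ≤ S)
    (hquasi : ∀ (i : ℕ) (h : Hol) (P : ℍ → ℂ[X]) (a : ℂ), ModerateGrowth h →
      HasExpansion Γ 2 2 h P → (∀ z, (P z).coeff 1 = a) →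
      ∃ (u : Hol) (Q : ℍ → ℂ[X]), ModerateGrowth u ∧ inWeight (2 + 2 * i) u ∈ S ∧
        HasExpansion Γ ((2 + 2 * i : ℕ) : ℤ) (i + 2) u Q ∧ ∀ z, (Q z).coeff (i + 1) = a)
    {k n : ℕ} {f : Hol} (hf : ModerateGrowth f) {P : ℍ → ℂ[X]} (hP : HasExpansion Γ k n f P) :
    inWeight k f ∈ S := by
  induction n generalizing f P with
  | zero =>
    have : f = 0 := Subtype.ext hP.eq_zero
    rw [this, map_zero]
    exact S.zero_mem
  | succ n ih =>
    have hf' : (f : ℍ → ℂ) ∈ modHol := ⟨f.2, hf⟩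
    -- it suffices to find an element of `S` with the same leading coefficient
    have reduce (u : Hol) (Q : ℍ → ℂ[X]) (hu : ModerateGrowth u) (huS : inWeight k u ∈ S)
        (hQ : HasExpansion Γ k (n + 1) u Q) (c : ℂ) (h : ∀ z, (P z).coeff n = c * (Q z).coeff n) :
        inWeight k f ∈ S := by
      have h1 : HasExpansion Γ k n (f + (-c) • u : Hol) (P + (-c) • Q) :=
        (hP.add (hQ.smul (-c))).of_coeff_eq_zero fun z => by simp [h]
      have h2 := ih (f := f + (-c) • u) (hf.add (hu.smul (-c))) h1
      have h3 : f = f + (-c) • u + c • u := by ext z; simp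
      rw [h3, map_add, map_smul]
      exact S.add_mem h2 (S.smul_mem c huS)
    -- The sign of k - 2n, the weight of the top coefficient: it vanishes, is constant, or is a
    -- modular form of positive weight.
    rcases lt_trichotomy k (2 * n) with hk | hk | hk
    · exact ih hf (hP.of_weight_neg hcov hΓ hf' (by exact_mod_cast hk))
    · obtain ⟨c, hc⟩ := hP.exists_leadingCoeff_eq_const hcov hΓ hf' (by exact_mod_cast hk)
      match n, hk with
      | 0, hk =>
        obtain rfl : k = 0 := by omega
        refine hconst (Submodule.mem_span_singleton.mpr ⟨c, ?_⟩)
        rw [← map_smul]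
        congr 1
        ext z
        rw [← hP.coeff_zero, hc]
        simp
      | n + 1, hk =>
        obtain rfl : k = 2 + 2 * n := by omega
        obtain ⟨h, hh, hhP⟩ := hP.exists_subleadingCoeff hΓ hf' hc
        have e : ((2 + 2 * n : ℕ) : ℤ) - 2 * n = 2 := by push_cast; ring
        rw [e] at hhP
        obtain ⟨u, Q, hu, huS, hQ, hQc⟩ := hquasi n h _ _ hh hhP fun z => by simp; rfl
        -- The subleading coefficient `h` has degree-one coefficient (n + 1)c, where c is the top
        -- coefficient of `f`; hence the inverse of n + 1.
        refine reduce u Q hu huS hQ ((n : ℂ) + 1)⁻¹ fun z => ?_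
        have : (n : ℂ) + 1 ≠ 0 := by exact_mod_cast n.succ_ne_zero
        rw [hQc, hc, inv_mul_cancel_left₀ this]
    · obtain ⟨h, hh, hhP⟩ := hP.exists_leadingCoeff hΓ hf'
      obtain ⟨m, rfl⟩ : ∃ m, k = m + 1 + 2 * n := ⟨k - 1 - 2 * n, by omega⟩
      have e : ((m + 1 + 2 * n : ℕ) : ℤ) - 2 * n = ((m + 1 : ℕ) : ℤ) := by push_cast; ring
      rw [e] at hh
      obtain ⟨Q, hQ, c, hc, hQc⟩ := (hasExpansion_of_mem_modularForms hh).iterate_deriv hΓ hh.1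
        (by push_cast; omega) n
      rw [zero_add] at hQ
      refine reduce ((D ^ n) h) Q (hh.1.iterate_deriv n) (hmod n ?_) (by exact_mod_cast hQ) c⁻¹
        fun z => ?_
      · rw [← gradedD_pow_inWeight]
        exact Submodule.mem_map_of_mem (Submodule.mem_iSup_of_mem m ⟨h, hh, rfl⟩)
      · have := hQc z
        rw [zero_add] at this
        rw [this, inv_mul_cancel_left₀ hc, coeff_C_zero, hhP]

lemma inWeight_mem_gradedQuasimodularForms {k : ℕ} {f : Hol} (hf : f ∈ quasimodularForms Γ k) :
    inWeight k f ∈ gradedQuasimodularForms Γ :=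
  Submodule.mem_iSup_of_mem k ⟨f, hf, rfl⟩

lemma modularSummands_le (hΓ : InfiniteRatios Γ) (a : Unit ⊕ ℕ) :
    modularSummands Γ a ≤ gradedQuasimodularForms Γ := by
  match a with
  | .inl () =>
    refine (Submodule.span_singleton_le_iff_mem _ _).mpr (inWeight_mem_gradedQuasimodularForms ?_)
    exact modularForms_le Γ _ ⟨ModerateGrowth.const 1, fun g _ z => by simp⟩
  | .inr i =>
    rw [modularSummands, gradedModularFormsPos, Submodule.map_iSup]
    refine iSup_le fun m => ?_
    rintro _ ⟨_, ⟨g, hg, rfl⟩, rfl⟩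
    rw [gradedD_pow_inWeight]
    refine inWeight_mem_gradedQuasimodularForms (mem_quasimodularForms_iff.mpr ?_)
    obtain ⟨Q, hQ, -⟩ := (hasExpansion_of_mem_modularForms hg).iterate_deriv hΓ hg.1
      (by push_cast; omega) i
    exact ⟨hg.1.iterate_deriv i, _, Q, by exact_mod_cast hQ⟩

/-- The cases `δ` = 0 and `δ(φ)` = 1 differ only in how `hquasi` is met: by the zero form, or by a
multiple of D^i(φ). -/
lemma gradedQuasimodularForms_le [Countable Γ] (hcov : FiniteCovolume Γ) (hΓ : InfiniteRatios Γ)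
    {S : Submodule ℂ GrHol} (hS : ∀ a, modularSummands Γ a ≤ S)
    (hquasi : ∀ (i : ℕ) (h : Hol) (P : ℍ → ℂ[X]) (a : ℂ), ModerateGrowth h →
      HasExpansion Γ 2 2 h P → (∀ z, (P z).coeff 1 = a) →
      ∃ (u : Hol) (Q : ℍ → ℂ[X]), ModerateGrowth u ∧ inWeight (2 + 2 * i) u ∈ S ∧
        HasExpansion Γ ((2 + 2 * i : ℕ) : ℤ) (i + 2) u Q ∧ ∀ z, (Q z).coeff (i + 1) = a) :
    gradedQuasimodularForms Γ ≤ S := by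
  refine iSup_le fun k => ?_
  rintro _ ⟨f, hf, rfl⟩
  obtain ⟨hf', n, P, hP⟩ := mem_quasimodularForms_iff.mp hf
  exact inWeight_mem_of_hasExpansion hcov hΓ (hS (.inl ())) (fun i => hS (.inr i)) hquasi hf' hP

end Graded

end QuasiMod

end

/-- Additive structure theorem for quasimodular forms. The map `δ` is `f ↦ f_1`, the coefficient of
`c / (c z + d)` in the expansion of `f`; it is part of the claim that `f_1` is constant and does not
depend on the expansion. -/
theorem theorem2 (Γ : Subgroup PSL(2, ℝ)) (hdisc : DiscreteTopology Γ)
    (hcov : QuasiMod.FiniteCovolume Γ) :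
    ∃ δ : QuasiMod.quasimodularForms Γ 2 →ₗ[ℂ] ℂ,
      (∀ (f : QuasiMod.quasimodularForms Γ 2) (p : ℕ) (P : ℍ → ℂ[X]),
        QuasiMod.IsExpansion Γ 2 p f P → ∀ z : ℍ, (P z).coeff 1 = δ f) ∧
      Function.Injective (Submodule.inclusion (QuasiMod.modularForms_le Γ 2)) ∧
      Function.Exact (Submodule.inclusion (QuasiMod.modularForms_le Γ 2)) δ ∧
      (LinearMap.range δ = ⊥ ↔ ¬ ∃ φ, δ φ = 1) ∧
      (LinearMap.range δ = ⊥ →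
        QuasiMod.IsDirectSumOf (QuasiMod.gradedQuasimodularForms Γ)
          (QuasiMod.modularSummands Γ)) ∧
      (∀ φ : QuasiMod.quasimodularForms Γ 2, δ φ = 1 →
        (∀ i : ℕ, QuasiMod.lineSummands φ i ≠ ⊥) ∧
        QuasiMod.IsDirectSumOf (QuasiMod.gradedQuasimodularForms Γ)
          (Sum.elim (QuasiMod.modularSummands Γ) (QuasiMod.lineSummands φ))) := by
  have := QuasiMod.countable_of_discreteTopology Γ
  have hΓ : QuasiMod.InfiniteRatios Γ := QuasiMod.infinite_ratio hcov
  obtain ⟨δ, hδ⟩ := QuasiMod.exists_delta hcov hΓ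
  refine ⟨δ, fun f p P hP z => hδ f _ P hP.hasExpansion z, Submodule.inclusion_injective _,
    QuasiMod.exact_delta hcov hΓ hδ, ?_, fun h0 => ?_, fun φ hφ => ?_⟩
  · rw [LinearMap.range_eq_bot]
    constructor
    · rintro rfl ⟨φ, hφ⟩
      simp at hφ
    · intro h
      ext f
      by_contra hf
      exact h ⟨(δ f)⁻¹ • f, by rw [map_smul]; exact inv_mul_cancel₀ hf⟩
  · refine ⟨QuasiMod.iSupIndep_modularSummands hΓ, le_antisymm ?_
      (iSup_le (QuasiMod.modularSummands_le hΓ))⟩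
    refine QuasiMod.gradedQuasimodularForms_le hcov hΓ (fun a => le_iSup _ a)
      fun i h P a hh hP ha => ?_
    -- Here a is the value of `δ` at the weight-two form `h`, so the zero form has the required top
    -- coefficient.
    have ha0 : a = 0 := by
      rw [← ha I, hδ ⟨h, QuasiMod.mem_quasimodularForms_iff.mpr ⟨hh, _, P, hP⟩⟩ _ P hP I,
        LinearMap.range_eq_bot.mp h0]
      rfl
    refine ⟨0, 0, QuasiMod.ModerateGrowth.zero, by simp, ⟨fun z => ?_, fun g _ z => by simp⟩,
      fun z => by simp [ha0]⟩
    rw [Pi.zero_apply, Polynomial.degree_zero]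
    exact WithBot.bot_lt_coe (i + 2)
  · obtain ⟨hφg, n, P, hP⟩ := QuasiMod.mem_quasimodularForms_iff.mp φ.2
    have hP2 := hP.depth_le_one hcov hΓ ⟨(φ : QuasiMod.Hol).2, hφg⟩
    have hP1 : ∀ z, (P z).coeff 1 = 1 := fun z => by rw [hδ φ _ P hP, hφ]
    have hdepth := QuasiMod.hasExactDepth_iterate_deriv hΓ hφg hP2 one_ne_zero hP1
    refine ⟨fun i => ?_, QuasiMod.iSupIndep_modularSummands_lineSummands hΓ hdepth,
      le_antisymm ?_ (iSup_le ?_)⟩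
    · rw [QuasiMod.lineSummands, Ne, Submodule.span_singleton_eq_bot,
        QuasiMod.gradedD_pow_inWeight]
      intro h
      refine (hdepth i).ne_zero hΓ ?_
      have := congrArg (fun v : QuasiMod.GrHol => v (2 + 2 * i)) h
      simp only [QuasiMod.inWeight_apply, if_true] at this
      rw [this]
      rfl
    · refine QuasiMod.gradedQuasimodularForms_le hcov hΓ
        (fun a => le_iSup (Sum.elim (QuasiMod.modularSummands Γ) (QuasiMod.lineSummands φ)) (.inl a))
        fun i h Q a hh hQ ha => ?_
      obtain ⟨R, hR, c, hc, hRc⟩ := hP2.iterate_deriv (n := 1) hΓ hφg (by norm_num) i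
      -- As `δ(φ)` = 1, the top coefficient of D^i(φ) is the nonzero constant `c`; rescaling turns
      -- it into a.
      refine ⟨(a * c⁻¹) • (QuasiMod.D ^ i) φ, (a * c⁻¹) • R, (hφg.iterate_deriv i).smul _, ?_, ?_,
        fun z => ?_⟩
      · rw [map_smul, ← QuasiMod.gradedD_pow_inWeight]
        refine Submodule.smul_mem _ _ (Submodule.mem_iSup_of_mem (.inr i) ?_)
        exact Submodule.mem_span_singleton_self _
      · rw [add_comm 1 i] at hR
        have := hR.smul (a * c⁻¹)
        exact_mod_cast this
      · have := hRc z
        rw [hP1, mul_one, add_comm 1 i] at this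
        simp [this, hc]
    · rintro (a | i)
      · exact QuasiMod.modularSummands_le hΓ a
      · refine (Submodule.span_singleton_le_iff_mem _ _).mpr ?_
        rw [QuasiMod.gradedD_pow_inWeight]
        obtain ⟨R, hR, -⟩ := hdepth i
        exact QuasiMod.inWeight_mem_gradedQuasimodularForms
          (QuasiMod.mem_quasimodularForms_iff.mpr ⟨hφg.iterate_deriv i, _, R, hR⟩)
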